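/- Let $X,Y$ be real reflexive Banach spaces, $Z_1,Z_2$ real Banach spaces, and let $K\subset X$ and $\Lambda\subset Y$ be nonempty, bounded, closed and convex. Assume: - $\phi\colon X\to(-\infty,\infty]$ is proper, convex and lower semicontinuous, and $D(\phi)\cap K\neq\varnothing$, where $D(\phi)=\{x:\phi(x)<\infty\}$; - $J\colon Z_1\to\mathbb R$ and $L\colon Z_2\to\mathbb R$ are locally Lipschitz; - $\gamma_1\colon X\to Z_1$ and $\gamma_2\colon Y\to Z_2$ are linear and compact; - $H\colon Y\to(0,m_H)$, for some $m_H>0$, is continuous for the weak topology of $Y$; - $B\colon X\times Y\to\mathbb R$ is (jointly) convex and lower semicontinuous; - $F\colon X\to X^*$ and $G\colon Y\to Y^*$ are (nonlinear) operators. For a locally Lipschitz $h\colon E\to\mathbb R$ on a Banach space $E$ write $h^0(x;y)=\limsup_{z\to x,\ t\downarrow0}\frac{h(z+ty)-h(z)}{t}$ and $\partial_Ch(x)=\{\xi\in E^*:\langle\xi,y\rangle\le h^0(x;y)\ \forall y\in E\}$. An operator $A\colon E\to E^*$ is hemicontinuous if $\lim_{t\to0_+}\langle A(u+t(v-u)),w\rangle=\langle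 A(u),w\rangle$ for all $u,v,w\in E$. For $\beta\colon E\to\mathbb R$, a set-valued $A\colon E\to2^{E^*}$ is $\beta$-relaxed dissipative if $\langle\zeta_y-\zeta_x,y-x\rangle\le\beta(y-x)$ for all $x,y\in E$, $\zeta_x\in A(x)$, $\zeta_y\in A(y)$ (a single-valued operator is regarded as set-valued). Consider the conditions on $F$: - $(H_F^1)$ for every $v\in X$, $\liminf_{n\to\infty}\langle F(u_n),v-u_n\rangle\ge\langle F(u),v-u\rangle$ whenever $u_n\rightharpoonup u$ in $X$; - $(H_F^2)$ $F$ is hemicontinuous and there is a concave $\beta_F\colon X\to\mathbb R$ with $\beta_F(0)\le0$ such that $F$ is $\beta_F$-relaxed dissipative; - $(H_F^3)$ $F$ is hemicontinuous and there is a concave $\beta_T\colon X\to\mathbb R$ with $\beta_T(0)\le0$ such that $T(u):=F(u)-\gamma_1^*\partial_CJ(\gamma_1(u))$ is $\beta_T$-relaxed dissipative; and on $G$: - $(H_G^1)$ for every $\mu\in Y$, $\liminf_{n\to\infty}\langle G(\sigma_n),\mu-\sigma_n\rangle\ge\langle G(\sigma),\mu-\sigma\rangle$ whenever $\sigma_n\rightharpoonup\sigma$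 in $Y$; - $(H_G^2)$ $G$ is hemicontinuous and there is a concave $\beta_G\colon Y\to\mathbb R$ with $\beta_G(0)\le0$ such that $G$ is $\beta_G$-relaxed dissipative; - $(H_G^3)$ $G$ is hemicontinuous and there is a concave $\beta_S\colon Y\to\mathbb R$ with $\beta_S(0)\le0$ such that $S(\sigma):=G(\sigma)-H(\sigma)\gamma_2^*\partial_CL(\gamma_2(\sigma))$ is $\beta_S$-relaxed dissipative. If $(H_F^j)$ and $(H_G^k)$ hold for some $j,k\in\{1,2,3\}$, then there exists $(u,\sigma)\in(K\cap D(\phi))\times\Lambda$ such that $$B(v,\sigma)-B(u,\sigma)+\phi(v)-\phi(u)+J^0(\gamma_1(u);\gamma_1(v-u))\ge\langle F(u),v-u\rangle\quad\text{for all }v\in K,$$ $$B(u,\mu)-B(u,\sigma)+H(\sigma)L^0(\gamma_2(\sigma);\gamma_2(\mu-\sigma))\ge\langle G(\sigma),\mu-\sigma\rangle\quad\text{for all }\mu\in\Lambda.$$ -/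

import Mathlib

open Filter Topology

namespace VarHemivar

noncomputable section

/-- A real normed space is reflexive if the canonical embedding into its bidual is onto. -/
def IsReflexive (E : Type*) [NormedAddCommGroup E] [NormedSpace ℝ E] : Prop :=
  Function.Surjective (NormedSpace.inclusionInDoubleDual ℝ E)

section OneSpace

variable {E : Type*} [NormedAddCommGroup E] [NormedSpace ℝ E]

/-- Weak convergence of sequences, `xₙ ⇀ x`. -/
def WeaklyTendsto (x : ℕ → E) (x₀ : E) : Prop :=
  Tendsto (fun n => toWeakSpace ℝ E (x n)) atTop (𝓝 (toWeakSpace ℝ E x₀))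

/-- Continuity of a real function with respect to the weak topology of `E`. -/
def WeaklyContinuous (h : E → ℝ) : Prop :=
  Continuous fun x : WeakSpace ℝ E => h ((toWeakSpace ℝ E).symm x)

/-- The effective domain `D(φ) = {x | φ x < +∞}`. -/
def effDomain (φ : E → EReal) : Set E := {x | φ x < ⊤}

/-- Convexity of a functional with values in `(-∞, +∞]`. -/
def IsConvex (φ : E → EReal) : Prop :=
  ∀ x y : E, ∀ t : ℝ, 0 ≤ t → t ≤ 1 →
    φ (t • x + (1 - t) • y) ≤ (t : EReal) * φ x + ((1 - t : ℝ) : EReal) * φ y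

/-- Clarke's generalized derivative `h⁰(x; y)`, the upper limit of `(h (z + t y) - h z) / t`
as `z → x` and `t ↓ 0`. -/
def clarkeDeriv (h : E → ℝ) (x y : E) : ℝ :=
  limsup (fun p : E × ℝ => (h (p.1 + p.2 • y) - h p.1) / p.2) (𝓝 x ×ˢ 𝓝[>] (0 : ℝ))

/-- The Clarke subdifferential `∂_C h(x)`. -/
def clarkeSubdiff (h : E → ℝ) (x : E) : Set (StrongDual ℝ E) :=
  {ξ | ∀ y : E, ξ y ≤ clarkeDeriv h x y}

/-- A set-valued mapping `A : E → 2^{E*}` is `β`-relaxed dissipative. -/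
def RelaxedDissipative (β : E → ℝ) (A : E → Set (StrongDual ℝ E)) : Prop :=
  ∀ x y : E, ∀ ζx ∈ A x, ∀ ζy ∈ A y, (ζy - ζx) (y - x) ≤ β (y - x)

/-- Hemicontinuity of a single-valued operator `A : E → E*`. -/
def Hemicontinuous (A : E → StrongDual ℝ E) : Prop :=
  ∀ u v w : E, Tendsto (fun t : ℝ => A (u + t • (v - u)) w) (𝓝[>] 0) (𝓝 (A u w))

/-- Condition (H¹): `u ↦ ⟨A u, v - u⟩` is weakly (sequentially) lower semicontinuous for every `v`.
The lower limit is taken in the extended reals. -/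
def CondH1 (A : E → StrongDual ℝ E) : Prop :=
  ∀ (v : E) (x : ℕ → E) (u : E), WeaklyTendsto x u →
    ((A u (v - u) : ℝ) : EReal) ≤
      liminf (fun n => ((A (x n) (v - x n) : ℝ) : EReal)) atTop

/-- `A` is `β`-relaxed dissipative for some concave `β : E → ℝ` with `β 0 ≤ 0`. -/
def ConcavelyDissipative (A : E → Set (StrongDual ℝ E)) : Prop :=
  ∃ β : E → ℝ, ConcaveOn ℝ Set.univ β ∧ β 0 ≤ 0 ∧ RelaxedDissipative β A

/-- Condition (H²). -/
def CondH2 (A : E → StrongDual ℝ E) : Prop :=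
  Hemicontinuous A ∧ ConcavelyDissipative fun x => {A x}

/-- The set-valued operator `x ↦ A x - c(x) γ* ∂_C h(γ x)`. -/
def shiftedOp {Z : Type*} [NormedAddCommGroup Z] [NormedSpace ℝ Z]
    (A : E → StrongDual ℝ E) (c : E → ℝ) (γ : E →L[ℝ] Z) (h : Z → ℝ) (x : E) :
    Set (StrongDual ℝ E) :=
  {ζ | ∃ ξ ∈ clarkeSubdiff h (γ x), ζ = A x - c x • (ξ.comp γ)}

/-- Condition (H³): `A` is hemicontinuous and `x ↦ A x - c(x) γ* ∂_C h(γ x)` is relaxed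
dissipative as in (H²). -/
def CondH3 {Z : Type*} [NormedAddCommGroup Z] [NormedSpace ℝ Z]
    (A : E → StrongDual ℝ E) (c : E → ℝ) (γ : E →L[ℝ] Z) (h : Z → ℝ) : Prop :=
  Hemicontinuous A ∧ ConcavelyDissipative (shiftedOp A c γ h)

end OneSpace

/-- `(u, σ)` solves the coupled system: `(u, σ) ∈ (K ∩ D(φ)) × Λ` and both inequalities hold
for all `v ∈ K` and all `μ ∈ Λ`. The first one is an inequality in `(-∞, +∞]`. -/
def IsSolution {X Y Z₁ Z₂ : Type*}
    [NormedAddCommGroup X] [NormedSpace ℝ X] [NormedAddCommGroup Y] [NormedSpace ℝ Y]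
    [NormedAddCommGroup Z₁] [NormedSpace ℝ Z₁] [NormedAddCommGroup Z₂] [NormedSpace ℝ Z₂]
    (K : Set X) (Λ : Set Y) (B : X × Y → ℝ) (φ : X → EReal)
    (γ₁ : X →L[ℝ] Z₁) (γ₂ : Y →L[ℝ] Z₂) (J : Z₁ → ℝ) (L : Z₂ → ℝ) (H : Y → ℝ)
    (F : X → StrongDual ℝ X) (G : Y → StrongDual ℝ Y) (u : X) (σ : Y) : Prop :=
  u ∈ K ∩ effDomain φ ∧ σ ∈ Λ ∧
  (∀ v ∈ K, ((F u (v - u) : ℝ) : EReal) ≤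
    ((B (v, σ) - B (u, σ) : ℝ) : EReal) + (φ v - φ u)
      + ((clarkeDeriv J (γ₁ u) (γ₁ (v - u)) : ℝ) : EReal)) ∧
  (∀ μ ∈ Λ, G σ (μ - σ) ≤
    B (u, μ) - B (u, σ) + H σ * clarkeDeriv L (γ₂ σ) (γ₂ (μ - σ)))

end

end VarHemivar

/-!
With `w = (u, σ)`, the two inequalities hold together exactly when `f w w' ≤ ψ w' - ψ w` for all
`w'` in `K × Λ`, where `ψ (u, σ) = φ u + B (u, σ)` and `f` is the sum of the two hemivariational
forms. Under any of the conditions H1, H2, H3 the form `f` has a minorant `g` for which the sets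
`{w | ψ w + g w w' ≤ ψ w'}` are weakly sequentially closed, and from which `f` is recovered along
segments by Minty's trick; in the dissipative cases this works because a concave `β` with `β 0 ≤ 0`
together with hemicontinuity forces actual dissipativity. These sets satisfy the covering condition
of Knaster, Kuratowski and Mazurkiewicz, and reflexivity makes them weakly compact once Whitley's
argument has turned sequential closedness into weak closedness. A common point is a solution.

The covering lemma follows from Brouwer's theorem. For the latter, `∫ det (1 + t • D q)` over a ball
is a polynomial in `t` and, when `q` vanishes on the sphere, is constant for small `t`; so a `C¹`
retraction `1 + q` onto the sphere, whose derivative is everywhere singular, cannot exist.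
-/

namespace VarHemivar

section Brouwer

open MeasureTheory Metric Set

theorem exists_polynomial_eval_eq_det_one_add_smul {R M : Type*} [CommRing R] [Nontrivial R]
    [AddCommGroup M] [Module R M] [Module.Free R M] [Module.Finite R M] (A : Module.End R M) :
    ∃ p : Polynomial R, p.natDegree ≤ Module.finrank R M ∧
      ∀ t, p.eval t = LinearMap.det (1 + t • A) := by
  let b := Module.finBasis R M
  let N := LinearMap.toMatrix b b A
  refine ⟨((Polynomial.X : Polynomial R) • N.map Polynomial.C +
    (1 : Matrix _ _ R).map Polynomial.C).det, ?_, fun t => ?_⟩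
  · exact (Polynomial.natDegree_det_X_add_C_le N 1).trans_eq (Fintype.card_fin _)
  · have hN : LinearMap.toMatrix b b (1 + t • A) = t • N + 1 := by
      rw [map_add, map_smul, LinearMap.toMatrix_one, add_comm]
    rw [← LinearMap.det_toMatrix b, hN, ← Polynomial.coe_evalRingHom, RingHom.map_det]
    congr 1
    ext i j
    by_cases hij : i = j <;> simp [hij, -Polynomial.X_mul_C]

theorem exists_weights_det_one_add_smul {𝕜 V : Type*} [Field 𝕜] [AddCommGroup V] [Module 𝕜 V]
    [FiniteDimensional 𝕜 V] {v : ℕ → 𝕜} (hv : Function.Injective v) :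
    ∃ w : ℕ → 𝕜, ∑ i ∈ Finset.range (Module.finrank 𝕜 V + 1), w i = 1 ∧
      ∀ A : Module.End 𝕜 V, LinearMap.det (1 + A) =
        ∑ i ∈ Finset.range (Module.finrank 𝕜 V + 1), w i * LinearMap.det (1 + v i • A) := by
  set s := Finset.range (Module.finrank 𝕜 V + 1) with hs
  refine ⟨fun i => (Lagrange.basis s v i).eval 1, ?_, fun A => ?_⟩
  · have hsum := congrArg (Polynomial.eval 1) (Lagrange.sum_basis hv.injOn (s := s) (by simp [s]))
    simpa only [Polynomial.eval_finsetSum, Polynomial.eval_one] using hsum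
  · obtain ⟨p, hp, hpA⟩ := exists_polynomial_eval_eq_det_one_add_smul A
    have hdeg : p.degree < s.card := by
      rw [hs, Finset.card_range]
      exact Polynomial.degree_le_natDegree.trans_lt (by exact_mod_cast Nat.lt_succ_of_le hp)
    have hinterp := congrArg (Polynomial.eval 1) (Lagrange.eq_interpolate hv.injOn hdeg)
    rw [hpA, one_smul, Lagrange.interpolate_apply] at hinterp
    simp only [hinterp, Polynomial.eval_finsetSum, Polynomial.eval_mul, Polynomial.eval_C, hpA,
      mul_comm]

theorem exists_injective_forall_mul_lt_one (C : NNReal) :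
    ∃ v : ℕ → NNReal, Function.Injective (fun i => (v i : ℝ)) ∧ ∀ i, v i * C < 1 := by
  refine ⟨fun i => ((C + 1) * (i + 1))⁻¹, fun i j hij => ?_, fun i => ?_⟩
  · have hinv : ((C + 1) * (i + 1))⁻¹ = ((C + 1) * (j + 1))⁻¹ := NNReal.coe_injective hij
    simpa using hinv
  · have hi : 1 ≤ (i : NNReal) + 1 := le_add_of_nonneg_left zero_le
    rw [inv_mul_lt_one₀ (by positivity)]
    calc C < C + 1 := lt_add_one C
      _ ≤ (C + 1) * (i + 1) := le_mul_of_one_le_right' hi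

theorem exists_norm_eq_and_norm_sub_eq {E : Type*} [NormedAddCommGroup E] [NormedSpace ℝ E]
    [Nontrivial E] {x : E} {R : ℝ} (hx : ‖x‖ ≤ R) :
    ∃ y, ‖y‖ = R ∧ ‖x - y‖ = R - ‖x‖ := by
  rcases eq_or_ne x 0 with rfl | hx0
  · obtain ⟨y, hy⟩ := exists_norm_eq E ((norm_nonneg _).trans hx)
    exact ⟨y, hy, by simpa using hy⟩
  · have hpos : 0 < ‖x‖ := norm_pos_iff.2 hx0
    have hsub : x - (R / ‖x‖) • x = (1 - R / ‖x‖) • x := by rw [sub_smul, one_smul]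
    have hle : 1 - R / ‖x‖ ≤ 0 := by rwa [sub_nonpos, one_le_div hpos]
    refine ⟨(R / ‖x‖) • x, ?_, ?_⟩
    · rw [norm_smul, norm_div, norm_norm, div_mul_cancel₀ _ hpos.ne',
        Real.norm_of_nonneg (hpos.le.trans hx)]
    · rw [hsub, norm_smul, Real.norm_of_nonpos hle]
      field_simp
      ring

theorem mapsTo_ball_of_approximatesLinearOn_id {E : Type*} [NormedAddCommGroup E] [NormedSpace ℝ E]
    [Nontrivial E] {h : E → E} {c : NNReal} {R : ℝ} (hc : c < 1)
    (hh : ApproximatesLinearOn h (ContinuousLinearMap.id ℝ E) (closedBall 0 R) c)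
    (hs : ∀ x ∈ sphere 0 R, h x = x) : MapsTo h (ball 0 R) (ball 0 R) := by
  intro x hx
  rw [mem_ball_zero_iff] at hx
  obtain ⟨y, hy, hxy⟩ := exists_norm_eq_and_norm_sub_eq hx.le
  have happrox : ‖h x - x‖ ≤ c * (R - ‖x‖) := by
    have := hh x (by simpa using hx.le) y (by simp [hy])
    simpa [hs y (by simpa using hy), hxy] using this
  rw [mem_ball_zero_iff]
  calc ‖h x‖ ≤ ‖h x - x‖ + ‖x‖ := norm_le_norm_sub_add _ _
    _ < R := by nlinarith [NNReal.coe_lt_one.2 hc]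

section NormedSpace

variable {E : Type*} [NormedAddCommGroup E] [NormedSpace ℝ E] [FiniteDimensional ℝ E]

theorem det_one_add_pos_of_norm_lt_one {A : E →L[ℝ] E} (hA : ‖A‖ < 1) : 0 < (1 + A).det := by
  have := FiniteDimensional.complete ℝ E
  have hne : ∀ t ∈ Icc (0 : ℝ) 1, (1 + t • A).det ≠ 0 := by
    intro t ht
    have hnorm : ‖-(t • A)‖ < 1 := by
      rw [norm_neg, norm_smul, Real.norm_of_nonneg ht.1]
      exact (mul_le_of_le_one_left (norm_nonneg A) ht.2).trans_lt hA
    have hunit : IsUnit (1 + t • A) := by simpa using isUnit_one_sub_of_norm_lt_one hnorm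
    exact ((hunit.map ContinuousLinearMap.toLinearMapRingHom).map LinearMap.det).ne_zero
  have hcont : Continuous fun t : ℝ => (1 + t • A).det :=
    ContinuousLinearMap.continuous_det.comp (by fun_prop)
  by_contra! hle
  obtain ⟨t, ht, h0⟩ := intermediate_value_Icc' zero_le_one hcont.continuousOn
    (show (0 : ℝ) ∈ Icc (1 + (1 : ℝ) • A).det (1 + (0 : ℝ) • A).det by
      simpa [ContinuousLinearMap.det] using hle)
  exact hne t ht h0

theorem injOn_and_image_ball_of_approximatesLinearOn_id [Nontrivial E] {h : E → E} {c : NNReal}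
    {R : ℝ} (hR : 0 < R) (hc : c < 1)
    (hh : ApproximatesLinearOn h (ContinuousLinearMap.id ℝ E) (closedBall 0 R) c)
    (hs : ∀ x ∈ sphere 0 R, h x = x) :
    InjOn h (ball 0 R) ∧ h '' ball 0 R = ball 0 R := by
  have := FiniteDimensional.complete ℝ E
  have hmaps := mapsTo_ball_of_approximatesLinearOn_id hc hh hs
  have hball : ApproximatesLinearOn h (ContinuousLinearEquiv.refl ℝ E : E →L[ℝ] E) (ball 0 R) c :=
    hh.mono_set ball_subset_closedBall
  have hcinv : c < ‖((ContinuousLinearEquiv.refl ℝ E).symm : E →L[ℝ] E)‖₊⁻¹ := by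
    have hnorm : ‖((ContinuousLinearEquiv.refl ℝ E).symm : E →L[ℝ] E)‖₊ = 1 := by ext; simp
    rwa [hnorm, inv_one]
  have hopen : IsOpen (h '' ball 0 R) :=
    hball.open_image (ContinuousLinearEquiv.refl ℝ E).toNonlinearRightInverse isOpen_ball
      (Or.inr hcinv)
  have hcompact : IsCompact (h '' closedBall 0 R) :=
    (isCompact_closedBall 0 R).image_of_continuousOn hh.continuousOn
  refine ⟨hball.injOn (Or.inr hcinv), Subset.antisymm hmaps.image_subset ?_⟩
  -- The image is open and, as `h` fixes the sphere, relatively closed in the ball.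
  refine (convex_ball 0 R).isPreconnected.subset_of_closure_inter_subset hopen
    ⟨h 0, hmaps (mem_ball_self hR), mem_image_of_mem _ (mem_ball_self hR)⟩ ?_
  rintro y ⟨hy, hyR⟩
  obtain ⟨x, hx, rfl⟩ : y ∈ h '' closedBall 0 R :=
    closure_minimal (image_mono ball_subset_closedBall) hcompact.isClosed hy
  rcases (mem_closedBall.1 hx).lt_or_eq with hlt | heq
  · exact mem_image_of_mem _ hlt
  · rw [hs x heq] at hyR
    exact absurd heq (mem_ball.1 hyR).ne

section Volume

variable [MeasurableSpace E] [BorelSpace E] (μ : Measure E) [μ.IsAddHaarMeasure] {q : E → E}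
  {R : ℝ}

theorem setIntegral_det_one_add_fderiv_of_lipschitzOnWith [Nontrivial E] (hR : 0 < R) {c : NNReal}
    (hc : c < 1) (hq : Differentiable ℝ q) (hlip : LipschitzOnWith c q (closedBall 0 R))
    (hs : ∀ x ∈ sphere 0 R, q x = 0) :
    ∫ x in ball 0 R, (1 + fderiv ℝ q x).det ∂μ = μ.real (ball 0 R) := by
  have happrox : ApproximatesLinearOn (fun x => x + q x) (ContinuousLinearMap.id ℝ E)
      (closedBall 0 R) c := fun x hx y hy => by
    have hsub : x + q x - (y + q y) - (x - y) = q x - q y := by abel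
    simpa only [ContinuousLinearMap.id_apply, hsub] using hlip.norm_sub_le hx hy
  obtain ⟨hinj, himage⟩ := injOn_and_image_ball_of_approximatesLinearOn_id hR hc happrox
    fun x hx => by rw [hs x hx, add_zero]
  have hderiv : ∀ x ∈ ball (0 : E) R,
      HasFDerivWithinAt (fun x => x + q x) (1 + fderiv ℝ q x) (ball 0 R) x := fun x _ =>
    ((hasFDerivAt_id x).add (hq x).hasFDerivAt).hasFDerivWithinAt
  have hpos : ∀ x ∈ ball (0 : E) R, 0 < (1 + fderiv ℝ q x).det := fun x hx =>
    det_one_add_pos_of_norm_lt_one ((norm_fderiv_le_of_lipschitzOn ℝ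
      (closedBall_mem_nhds_of_mem hx) hlip).trans_lt (mod_cast hc))
  calc ∫ x in ball 0 R, (1 + fderiv ℝ q x).det ∂μ
      = ∫ x in ball 0 R, |(1 + fderiv ℝ q x).det| • (1 : ℝ) ∂μ :=
        setIntegral_congr_fun measurableSet_ball fun x hx => by
          rw [smul_eq_mul, mul_one, abs_of_pos (hpos x hx)]
    _ = ∫ _ in ball 0 R, (1 : ℝ) ∂μ := by
        rw [← integral_image_eq_integral_abs_det_fderiv_smul μ measurableSet_ball hderiv hinj
          fun _ => 1, himage]
    _ = μ.real (ball 0 R) := by simp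

theorem setIntegral_det_one_add_fderiv [Nontrivial E] (hR : 0 < R) (hq : ContDiff ℝ 1 q)
    (hs : ∀ x ∈ sphere 0 R, q x = 0) :
    ∫ x in ball 0 R, (1 + fderiv ℝ q x).det ∂μ = μ.real (ball 0 R) := by
  obtain ⟨C, hC⟩ := hq.locallyLipschitz.locallyLipschitzOn.exists_lipschitzOnWith_of_compact
    (isCompact_closedBall (0 : E) R)
  have hdiff := hq.differentiable one_ne_zero
  have hdet : ∀ t : ℝ, Continuous fun x => (1 + t • fderiv ℝ q x).det := fun t =>
    ContinuousLinearMap.continuous_det.comp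
      (continuous_const.add ((hq.continuous_fderiv one_ne_zero).const_smul t))
  have hint : ∀ t : ℝ, IntegrableOn (fun x => (1 + t • fderiv ℝ q x).det) (ball 0 R) μ := fun t =>
    ((hdet t).continuousOn.integrableOn_compact (isCompact_closedBall 0 R)).mono_set
      ball_subset_closedBall
  obtain ⟨v, hv, hvC⟩ := exists_injective_forall_mul_lt_one C
  have hlip : ∀ i, LipschitzOnWith (v i * C) (fun x => (v i : ℝ) • q x) (closedBall 0 R) :=
    fun i => by
      have hsmul := (lipschitzWith_smul (v i : ℝ) (β := E)).comp_lipschitzOnWith hC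
      rwa [NNReal.nnnorm_eq] at hsmul
  have hvol : ∀ i, ∫ x in ball 0 R, (1 + (v i : ℝ) • fderiv ℝ q x).det ∂μ = μ.real (ball 0 R) := by
    intro i
    rw [← setIntegral_det_one_add_fderiv_of_lipschitzOnWith μ hR (hvC i)
      (hdiff.const_smul (v i : ℝ)) (hlip i) fun x hx => by simp [hs x hx]]
    simp only [fderiv_const_smul (hdiff _)]
  -- `det (1 + t q')` is polynomial in `t`, so the small values of `t` determine the value at `1`.
  obtain ⟨w, hw1, hw⟩ := exists_weights_det_one_add_smul (V := E) hv
  calc ∫ x in ball 0 R, (1 + fderiv ℝ q x).det ∂μ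
      = ∫ x in ball 0 R, ∑ i ∈ Finset.range (Module.finrank ℝ E + 1),
          w i * (1 + (v i : ℝ) • fderiv ℝ q x).det ∂μ :=
        integral_congr_ae (Eventually.of_forall fun x => hw (fderiv ℝ q x))
    _ = ∑ i ∈ Finset.range (Module.finrank ℝ E + 1), w i * μ.real (ball 0 R) := by
        rw [integral_finsetSum _ fun i _ => (hint (v i)).const_mul _]
        simp_rw [integral_const_mul, hvol]
    _ = μ.real (ball 0 R) := by rw [← Finset.sum_mul, hw1, one_mul]

end Volume

end NormedSpace

section InnerProductSpace

variable {E : Type*} [NormedAddCommGroup E] [InnerProductSpace ℝ E]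

theorem det_eq_zero_of_norm_eventually_eq [FiniteDimensional ℝ E] {r : E → E} {r' : E →L[ℝ] E}
    {x : E} (hr : HasFDerivAt r r' x) (hnorm : ∀ᶠ y in 𝓝 x, ‖r y‖ = ‖r x‖) (hx : r x ≠ 0) :
    r'.det = 0 := by
  have horth : ∀ v, inner ℝ (r x) (r' v) = 0 := by
    have hconst : (fun y => ‖r y‖ ^ 2) =ᶠ[𝓝 x] fun _ => ‖r x‖ ^ 2 :=
      hnorm.mono fun y hy => by simp only [hy]
    have hzero := hr.norm_sq.unique ((hasFDerivAt_const _ x).congr_of_eventuallyEq hconst)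
    exact fun v => by simpa using DFunLike.congr_fun hzero v
  by_contra hdet
  obtain ⟨v, hv⟩ := (LinearMap.equivOfIsUnitDet (isUnit_iff_ne_zero.2 hdet)).surjective (r x)
  have hv' : r' v = r x := by rw [← hv, LinearMap.equivOfIsUnitDet_apply]; rfl
  exact hx (inner_self_eq_zero.1 (hv' ▸ horth v))

theorem not_exists_contDiff_retraction_sphere [FiniteDimensional ℝ E] {R : ℝ} (hR : 0 < R) :
    ¬∃ r : E → E, ContDiff ℝ 1 r ∧ (∀ x, ‖r x‖ = R) ∧ ∀ x ∈ sphere 0 R, r x = x := by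
  rintro ⟨r, hr, hnorm, hsphere⟩
  have hne : ∀ x, r x ≠ 0 := fun x => norm_pos_iff.1 ((hnorm x).symm ▸ hR)
  have : Nontrivial E := ⟨r 0, 0, hne 0⟩
  borelize E
  let μ : Measure E := Measure.addHaar
  have hfderiv : ∀ x, 1 + fderiv ℝ (fun y => r y - y) x = fderiv ℝ r x := fun x => by
    rw [fderiv_fun_sub (hr.differentiable one_ne_zero x) differentiableAt_fun_id, fderiv_fun_id]
    exact add_sub_cancel _ _
  have hdet : ∀ x, (fderiv ℝ r x).det = 0 := fun x =>
    det_eq_zero_of_norm_eventually_eq (hr.differentiable one_ne_zero x).hasFDerivAt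
      (Eventually.of_forall fun y => by rw [hnorm, hnorm]) (hne x)
  have hvol := setIntegral_det_one_add_fderiv μ hR (hr.sub contDiff_id) fun x hx => by
    simp [hsphere x hx]
  simp only [id_def, hfderiv, hdet, integral_zero] at hvol
  exact (ENNReal.toReal_pos (measure_ball_pos μ (0 : E) hR).ne' measure_ball_lt_top.ne).ne hvol

theorem exists_isFixedPt_of_support_subset_ball [FiniteDimensional ℝ E] {g : E → E}
    (hg : Continuous g) {R : ℝ} (hR : 0 < R) (hsupp : Function.support g ⊆ ball 0 R) :
    ∃ x, Function.IsFixedPt g x := by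
  by_contra! hne
  -- A fixed-point free `g` has a fixed-point free `C¹` approximation `p` with smaller support, and
  -- `x ↦ x - p x`, rescaled to norm `R`, is then a retraction.
  obtain ⟨p, hp, hpg, hps⟩ := hg.exists_contDiff_approx (ε := fun x => ‖x - g x‖) 1
    (by fun_prop) fun x => norm_pos_iff.2 (sub_ne_zero.2 (Ne.symm (hne x)))
  have hp_ne : ∀ x, x - p x ≠ 0 := fun x h0 => by
    have hdist := hpg x
    rw [← sub_eq_zero.1 h0, dist_eq_norm] at hdist
    exact hdist.false
  have hsub : ContDiff ℝ 1 fun x => x - p x := contDiff_id.sub hp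
  refine not_exists_contDiff_retraction_sphere (E := E) hR
    ⟨fun x => (R * ‖x - p x‖⁻¹) • (x - p x),
      (contDiff_const.mul ((hsub.norm ℝ hp_ne).inv fun x => norm_ne_zero_iff.2 (hp_ne x))).smul
        hsub, fun x => ?_, fun x hx => ?_⟩
  · rw [norm_smul, norm_mul, norm_inv, norm_norm, Real.norm_of_nonneg hR.le, mul_assoc,
      inv_mul_cancel₀ (norm_ne_zero_iff.2 (hp_ne x)), mul_one]
  · have hpx : p x = 0 := by
      by_contra h
      exact (mem_ball.1 (hsupp (hps h))).ne (mem_sphere.1 hx)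
    rw [mem_sphere_zero_iff_norm] at hx
    simp only [hpx, sub_zero, hx, mul_inv_cancel₀ hR.ne', one_smul]

theorem exists_isFixedPt_of_norm_le [FiniteDimensional ℝ E] {f : E → E} (hf : Continuous f)
    {R : ℝ} (hfR : ∀ x, ‖f x‖ ≤ R) : ∃ x, Function.IsFixedPt f x := by
  have hR : 0 ≤ R := (norm_nonneg _).trans (hfR 0)
  let χ : E → ℝ := fun x => max 0 (min 1 (R + 1 - ‖x‖))
  obtain ⟨x, hx⟩ := exists_isFixedPt_of_support_subset_ball (g := fun x => χ x • f x)
    (by fun_prop) (add_pos_of_nonneg_of_pos hR one_pos) fun x hx => by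
      by_contra hxR
      have hχ : χ x = 0 := max_eq_left ((min_le_right _ _).trans (by simpa using hxR))
      simp [hχ] at hx
  have hχ0 : 0 ≤ χ x := le_max_left _ _
  have hχ1 : χ x ≤ 1 := max_le zero_le_one (min_le_left _ _)
  have hxR : ‖x‖ ≤ R := by
    rw [← hx.eq, norm_smul, Real.norm_of_nonneg hχ0]
    exact (mul_le_of_le_one_left (norm_nonneg _) hχ1).trans (hfR x)
  have hχ : χ x = 1 := by simp [χ, min_eq_left (show 1 ≤ R + 1 - ‖x‖ by linarith)]
  exact ⟨x, by simpa only [Function.IsFixedPt, hχ, one_smul] using hx⟩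

theorem exists_lipschitzWith_one_retraction {K : Set E} (hne : K.Nonempty) (hK : IsComplete K)
    (hconv : Convex ℝ K) : ∃ r : E → E, LipschitzWith 1 r ∧ (∀ x, r x ∈ K) ∧ ∀ x ∈ K, r x = x := by
  choose r hrK hr using exists_norm_eq_iInf_of_complete_convex hne hK hconv
  have hangle : ∀ x, ∀ w ∈ K, inner ℝ (x - r x) (w - r x) ≤ 0 := fun x =>
    (norm_eq_iInf_iff_real_inner_le_zero hconv (hrK x)).1 (hr x)
  refine ⟨r, LipschitzWith.of_dist_le_mul fun x y => ?_, hrK, fun x hx => ?_⟩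
  · have hsum : ‖r x - r y‖ ^ 2 ≤ inner ℝ (x - y) (r x - r y) := by
      have hx := hangle x (r y) (hrK y)
      have hy := hangle y (r x) (hrK x)
      rw [← real_inner_self_eq_norm_sq]
      simp only [inner_sub_left, inner_sub_right] at hx hy ⊢
      linarith
    have hcs : ‖r x - r y‖ * ‖r x - r y‖ ≤ ‖x - y‖ * ‖r x - r y‖ :=
      (sq ‖r x - r y‖ ▸ hsum).trans (real_inner_le_norm _ _)
    rw [dist_eq_norm, dist_eq_norm, NNReal.coe_one, one_mul]
    rcases (norm_nonneg (r x - r y)).eq_or_lt with h0 | hpos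
    · exact h0 ▸ norm_nonneg _
    · exact le_of_mul_le_mul_right hcs hpos
  · exact (sub_eq_zero.1 (real_inner_self_nonpos.1 (hangle x x hx))).symm

theorem exists_isFixedPt_of_isCompact_convex_inner [FiniteDimensional ℝ E] {K : Set E}
    (hne : K.Nonempty) (hK : IsCompact K) (hconv : Convex ℝ K) {f : E → E} (hf : ContinuousOn f K)
    (hmaps : MapsTo f K K) : ∃ x ∈ K, Function.IsFixedPt f x := by
  obtain ⟨r, hr, hrK, hr_id⟩ := exists_lipschitzWith_one_retraction hne hK.isComplete hconv
  obtain ⟨C, hC⟩ := hK.isBounded.exists_norm_le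
  obtain ⟨x, hx⟩ := exists_isFixedPt_of_norm_le (hf.comp_continuous hr.continuous hrK)
    fun x => hC _ (hmaps (hrK x))
  have hxK : x ∈ K := hx.eq ▸ hmaps (hrK x)
  exact ⟨x, hxK, by simpa only [Function.IsFixedPt, Function.comp_apply, hr_id x hxK] using hx⟩

end InnerProductSpace

/-- **Brouwer's fixed point theorem**. -/
theorem exists_isFixedPt_of_isCompact_convex {E : Type*} [NormedAddCommGroup E] [NormedSpace ℝ E]
    [FiniteDimensional ℝ E] {K : Set E} (hne : K.Nonempty) (hK : IsCompact K)
    (hconv : Convex ℝ K) {f : E → E} (hf : ContinuousOn f K) (hmaps : MapsTo f K K) :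
    ∃ x ∈ K, Function.IsFixedPt f x := by
  let e := toEuclidean (E := E)
  obtain ⟨_, ⟨x, hx, rfl⟩, hfx⟩ := exists_isFixedPt_of_isCompact_convex_inner (hne.image e)
    (hK.image e.continuous) (hconv.is_linear_image e.toLinearMap.isLinear)
    (f := fun y => e (f (e.symm y)))
    (e.continuous.comp_continuousOn (hf.comp e.symm.continuous.continuousOn
      (by rintro _ ⟨x, hx, rfl⟩; simpa using hx)))
    (by rintro _ ⟨x, hx, rfl⟩; simpa using mem_image_of_mem e (hmaps hx))
  exact ⟨x, hx, e.injective (by simpa using hfx.eq)⟩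

end Brouwer

section KKM

open Set

variable {ι : Type*} [Fintype ι]

/-- The **Knaster–Kuratowski–Mazurkiewicz lemma** for coverings of a simplex. -/
theorem exists_mem_stdSimplex_forall_mem [Nonempty ι] {C : ι → Set (ι → ℝ)}
    (hC : ∀ i, IsClosed (C i)) (hcov : ∀ x ∈ stdSimplex ℝ ι, ∃ i, 0 < x i ∧ x ∈ C i) :
    ∃ x ∈ stdSimplex ℝ ι, ∀ i, x ∈ C i := by
  classical
  have hne : ∀ i, (C i).Nonempty := fun i => by
    obtain ⟨j, hj, hjC⟩ := hcov _ (single_mem_stdSimplex ℝ i)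
    obtain rfl : j = i := by
      by_contra h
      simp [h] at hj
    exact ⟨_, hjC⟩
  by_contra! hempty
  -- At a fixed point of `x ↦ (d i x / ∑ j, d j x)ᵢ`, a coordinate `i` with `0 < x i` and `x ∈ C i`
  -- satisfies `0 < x i = d i x / ∑ j, d j x = 0`.
  let d : ι → (ι → ℝ) → ℝ := fun i x => Metric.infDist x (C i)
  have hd_nonneg : ∀ i x, 0 ≤ d i x := fun i x => Metric.infDist_nonneg
  have hsum_pos : ∀ x ∈ stdSimplex ℝ ι, 0 < ∑ i, d i x := fun x hx => by
    obtain ⟨i, hi⟩ := hempty x hx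
    exact Finset.sum_pos' (fun i _ => hd_nonneg i x)
      ⟨i, Finset.mem_univ i, ((hC i).notMem_iff_infDist_pos (hne i)).1 hi⟩
  obtain ⟨x, hx, hfix⟩ := exists_isFixedPt_of_isCompact_convex (E := ι → ℝ)
    ⟨_, single_mem_stdSimplex ℝ (Classical.arbitrary ι)⟩ (isCompact_stdSimplex ℝ ι)
    (convex_stdSimplex ℝ ι) (f := fun x i => d i x / ∑ j, d j x)
    (continuousOn_pi.2 fun i => ContinuousOn.div (Metric.continuous_infDist_pt _).continuousOn
      (continuous_finsetSum _ fun j _ => Metric.continuous_infDist_pt _).continuousOn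
      fun x hx => (hsum_pos x hx).ne')
    (fun x hx => ⟨fun i => div_nonneg (hd_nonneg i x) (hsum_pos x hx).le, by
      rw [← Finset.sum_div, div_self (hsum_pos x hx).ne']⟩)
  obtain ⟨i, hi, hiC⟩ := hcov x hx
  have hxi : d i x / ∑ j, d j x = x i := congrFun hfix i
  rw [show d i x = 0 from Metric.infDist_zero_of_mem hiC, zero_div] at hxi
  exact hi.ne hxi

end KKM

section WeakTopology

variable {E : Type*} [NormedAddCommGroup E] [NormedSpace ℝ E]

theorem weaklyTendsto_iff {x : ℕ → E} {u : E} :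
    WeaklyTendsto x u ↔ ∀ f : StrongDual ℝ E, Tendsto (fun n => f (x n)) atTop (𝓝 (f u)) :=
  WeakBilin.tendsto_iff_forall_eval_tendsto _ fun _ _ h =>
    (SeparatingDual.eq_iff_forall_dual_eq (R := ℝ)).2 fun f => congrArg (fun g => g f) h

theorem weaklyTendsto_of_tendsto {x : ℕ → E} {u : E} (hx : Tendsto x atTop (𝓝 u)) :
    WeaklyTendsto x u :=
  ((toWeakSpaceCLM ℝ E).continuous.tendsto u).comp hx

theorem WeaklyTendsto.comp_clm {F : Type*} [NormedAddCommGroup F] [NormedSpace ℝ F]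
    {x : ℕ → E} {u : E} (hx : WeaklyTendsto x u) (T : E →L[ℝ] F) :
    WeaklyTendsto (fun n => T (x n)) (T u) :=
  weaklyTendsto_iff.2 fun f => weaklyTendsto_iff.1 hx (f.comp T)

theorem WeaklyContinuous.tendsto {h : E → ℝ} (hh : WeaklyContinuous h) {x : ℕ → E} {u : E}
    (hx : WeaklyTendsto x u) : Tendsto (fun n => h (x n)) atTop (𝓝 (h u)) :=
  (Continuous.tendsto hh (toWeakSpace ℝ E u)).comp hx

theorem WeaklyContinuous.continuous {h : E → ℝ} (hh : WeaklyContinuous h) : Continuous h :=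
  hh.comp (toWeakSpaceCLM ℝ E).continuous

theorem continuous_toWeakSpace_symm_dual (f : StrongDual ℝ E) :
    Continuous fun x : WeakSpace ℝ E => f ((toWeakSpace ℝ E).symm x) :=
  WeakBilin.eval_continuous (topDualPairing ℝ E).flip f

theorem WeaklyTendsto.exists_norm_le {x : ℕ → E} {u : E} (hx : WeaklyTendsto x u) :
    ∃ R, ∀ n, ‖x n‖ ≤ R := by
  obtain ⟨R, hR⟩ := banach_steinhaus (g := fun n => NormedSpace.inclusionInDoubleDual ℝ E (x n))
    fun f => (Metric.isBounded_range_of_tendsto _ (weaklyTendsto_iff.1 hx f)).exists_norm_le.imp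
      fun _ hC n => hC _ ⟨n, rfl⟩
  exact ⟨R, fun n => ((NormedSpace.inclusionInDoubleDualLi ℝ (E := E)).norm_map (x n)).symm.trans_le
    (hR n)⟩

theorem isClosed_image_toWeakSpace {s : Set E} (hs : IsClosed s) (hconv : Convex ℝ s) :
    IsClosed (toWeakSpace ℝ E '' s) := by
  rw [← closure_eq_iff_isClosed, ← hconv.toWeakSpace_closure ℝ, hs.closure_eq]

theorem mem_of_weaklyTendsto_of_frequently {s : Set E} (hs : IsClosed s) (hconv : Convex ℝ s)
    {x : ℕ → E} {u : E} (hx : WeaklyTendsto x u) (hxs : ∃ᶠ n in atTop, x n ∈ s) : u ∈ s :=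
  (toWeakSpace ℝ E).injective.mem_set_image.1 <|
    (isClosed_image_toWeakSpace hs hconv).mem_of_frequently_of_tendsto
      (hxs.mono fun _ => Set.mem_image_of_mem _) hx

theorem WeaklyTendsto.tendsto_of_isCompactOperator {F : Type*} [NormedAddCommGroup F]
    [NormedSpace ℝ F] {T : E →L[ℝ] F} (hT : IsCompactOperator T) {x : ℕ → E} {u : E}
    (hx : WeaklyTendsto x u) : Tendsto (fun n => T (x n)) atTop (𝓝 (T u)) := by
  obtain ⟨R, hR⟩ := hx.exists_norm_le
  refine (hT.isCompact_closure_image_closedBall R).tendsto_nhds_of_unique_mapClusterPt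
    (Eventually.of_forall fun n => subset_closure ⟨x n, by simpa using hR n, rfl⟩) ?_
  intro y _ hy
  refine (SeparatingDual.eq_iff_forall_dual_eq (R := ℝ)).2 fun f => ?_
  have hfy : MapClusterPt (f y) atTop fun n => f (T (x n)) :=
    hy.continuousAt_comp f.continuous.continuousAt
  exact eq_of_nhds_neBot (hfy.clusterPt.mono (weaklyTendsto_iff.1 (hx.comp_clm T) f)).neBot

/-- Closedness under weak limits of sequences. -/
def IsWeaklySeqClosed (A : Set E) : Prop :=
  ∀ ⦃x : ℕ → E⦄ ⦃u : E⦄, (∀ n, x n ∈ A) → WeaklyTendsto x u → u ∈ A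

theorem IsWeaklySeqClosed.isClosed {A : Set E} (hA : IsWeaklySeqClosed A) : IsClosed A :=
  IsSeqClosed.isClosed fun _ _ hx hxu => hA hx (weaklyTendsto_of_tendsto hxu)

end WeakTopology

section Reflexive

variable {E : Type*} [NormedAddCommGroup E] [NormedSpace ℝ E]

theorem IsReflexive.prod {F : Type*} [NormedAddCommGroup F] [NormedSpace ℝ F]
    (hE : IsReflexive E) (hF : IsReflexive F) : IsReflexive (E × F) := by
  intro ξ
  obtain ⟨x, hx⟩ := hE (ξ.comp ((ContinuousLinearMap.compL ℝ (E × F) E ℝ).flip (.fst ℝ E F)))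
  obtain ⟨y, hy⟩ := hF (ξ.comp ((ContinuousLinearMap.compL ℝ (E × F) F ℝ).flip (.snd ℝ E F)))
  have hx' : ∀ f : StrongDual ℝ E, f x = ξ (f.comp (.fst ℝ E F)) := fun f =>
    congrArg (fun g => g f) hx
  have hy' : ∀ f : StrongDual ℝ F, f y = ξ (f.comp (.snd ℝ E F)) := fun f =>
    congrArg (fun g => g f) hy
  refine ⟨(x, y), ContinuousLinearMap.ext fun f => ?_⟩
  have hf : f = (f.comp (.inl ℝ E F)).comp (.fst ℝ E F) +
      (f.comp (.inr ℝ E F)).comp (.snd ℝ E F) :=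
    ContinuousLinearMap.ext fun z => by simp [← map_add]
  calc f (x, y) = f.comp (.inl ℝ E F) x + f.comp (.inr ℝ E F) y := by simp [← map_add]
    _ = ξ ((f.comp (.inl ℝ E F)).comp (.fst ℝ E F) +
          (f.comp (.inr ℝ E F)).comp (.snd ℝ E F)) := by rw [map_add, hx', hy']
    _ = ξ f := by rw [← hf]

theorem IsReflexive.isCompact_closure_image_toWeakSpace (hE : IsReflexive E) {A : Set E}
    (hA : Bornology.IsBounded A) : IsCompact (closure (toWeakSpace ℝ E '' A)) := by
  refine NormedSpace.isCompact_closure_of_isBounded ℝ E _ ?_ ?_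
  · rwa [Set.preimage_image_eq _ (toWeakSpace ℝ E).injective]
  · have hsurj : Function.Surjective (NormedSpace.inclusionInDoubleDualWeak ℝ E) := fun ξ => by
      obtain ⟨x, hx⟩ := hE (WeakDual.toStrongDual ξ)
      exact ⟨toWeakSpace ℝ E x, by
        rw [← WeakDual.toStrongDual_inj, ← hx]; rfl⟩
    rw [hsurj.range_eq]
    exact Set.subset_univ _

end Reflexive

section EberleinSmulian

variable {E : Type*} [NormedAddCommGroup E] [NormedSpace ℝ E]

/-- The functionals in `Φ` of norm at most one recover the norm on `V` up to the factor `c`. -/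
def IsNorming (c : ℝ) (Φ : Set (StrongDual ℝ E)) (V : Set E) : Prop :=
  ∀ x ∈ V, ∃ φ ∈ Φ, ‖φ‖ ≤ 1 ∧ c * ‖x‖ ≤ φ x

theorem IsNorming.mono {c : ℝ} {Φ Ψ : Set (StrongDual ℝ E)} {V : Set E} (h : IsNorming c Φ V)
    (hΦΨ : Φ ⊆ Ψ) : IsNorming c Ψ V :=
  fun x hx => (h x hx).imp fun _ hφ => ⟨hΦΨ hφ.1, hφ.2⟩

theorem IsNorming.eq_zero_of_mem_closure {c : ℝ} (hc : 0 < c) {Φ : Set (StrongDual ℝ E)}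
    {V : Set E} (hΦ : IsNorming c Φ V) {x : E} (hx : x ∈ closure V) (h0 : ∀ φ ∈ Φ, φ x = 0) :
    x = 0 := by
  have hV : ∀ v ∈ V, c * ‖v‖ ≤ ‖v - x‖ := fun v hv => by
    obtain ⟨φ, hφΦ, hφ1, hφv⟩ := hΦ v hv
    calc c * ‖v‖ ≤ φ (v - x) := by rwa [map_sub, h0 φ hφΦ, sub_zero]
      _ ≤ ‖φ (v - x)‖ := Real.le_norm_self _
      _ ≤ ‖v - x‖ := φ.le_of_opNorm_le_of_le hφ1 le_rfl |>.trans_eq (one_mul _)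
  have hclosed : IsClosed {v | c * ‖v‖ ≤ ‖v - x‖} := isClosed_le (by fun_prop) (by fun_prop)
  have hcx : c * ‖x‖ ≤ ‖x - x‖ := closure_minimal hV hclosed hx
  rw [sub_self, norm_zero] at hcx
  exact norm_le_zero_iff.1 (nonpos_of_mul_nonpos_right hcx hc)

theorem exists_finset_isNorming (V : Submodule ℝ E) [FiniteDimensional ℝ V] {c : ℝ} (hc : c < 1) :
    ∃ Φ : Finset (StrongDual ℝ E), IsNorming c Φ (V : Set E) := by
  classical
  choose φ hφ1 hφ using fun x : E => exists_dual_vector'' ℝ x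
  have hK : IsCompact ((fun x : V => (x : E)) '' Metric.sphere 0 1) :=
    (isCompact_sphere _ _).image continuous_subtype_val
  obtain ⟨t, -, hcov⟩ := hK.elim_nhds_subcover (fun x => {z | c < φ x z}) <| by
    rintro _ ⟨x, hx, rfl⟩
    refine (isOpen_lt continuous_const (φ x).continuous).mem_nhds ?_
    have hx1 : ‖(x : E)‖ = 1 := by simpa using hx
    simpa [hφ, hx1] using hc
  refine ⟨insert 0 (t.image φ), fun x hx => ?_⟩
  rcases eq_or_ne x 0 with rfl | hx0
  · exact ⟨0, by simp⟩
  have hpos : 0 < ‖x‖ := norm_pos_iff.2 hx0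
  obtain ⟨y, hy, hlt⟩ := Set.mem_iUnion₂.1 <| hcov
    ⟨⟨‖x‖⁻¹ • x, V.smul_mem _ hx⟩, by simp [norm_smul, hpos.ne'], rfl⟩
  refine ⟨φ y, by simpa using Or.inr ⟨y, hy, rfl⟩, hφ1 y, ?_⟩
  have hlt' : c < ‖x‖⁻¹ * φ y x := by simpa using hlt
  exact ((lt_inv_mul_iff₀' hpos).1 hlt').le

theorem exists_mem_forall_abs_sub_lt_of_mem_closure {A : Set E} {w : E}
    (hw : toWeakSpace ℝ E w ∈ closure (toWeakSpace ℝ E '' A)) (Φ : Finset (StrongDual ℝ E))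
    {ε : ℝ} (hε : 0 < ε) : ∃ a ∈ A, ∀ φ ∈ Φ, |φ a - φ w| < ε := by
  have hnhds : ∀ᶠ x : WeakSpace ℝ E in 𝓝 (toWeakSpace ℝ E w),
      ∀ φ ∈ Φ, |φ ((toWeakSpace ℝ E).symm x) - φ w| < ε := by
    refine (eventually_all_finset Φ).2 fun φ _ => ?_
    have hcont := (continuous_toWeakSpace_symm_dual φ).tendsto (toWeakSpace ℝ E w)
    simpa [Real.dist_eq] using Metric.tendsto_nhds.1 hcont ε hε
  obtain ⟨_, ⟨a, ha, rfl⟩, hlt⟩ := (mem_closure_iff_frequently.1 hw).and_eventually hnhds |>.exists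
  exact ⟨a, ha, by simpa using hlt⟩

-- Whitley's construction: `x n` is chosen against functionals norming the span of `w` and the
-- earlier terms, so that in the limit these functionals norm the span of the whole sequence.
theorem exists_seq_isNorming_of_mem_closure {A : Set E} {w : E}
    (hw : toWeakSpace ℝ E w ∈ closure (toWeakSpace ℝ E '' A)) {c : ℝ} (hc : c < 1) :
    ∃ (x : ℕ → E) (Φ : Set (StrongDual ℝ E)), (∀ n, x n ∈ A) ∧
      (∀ φ ∈ Φ, Tendsto (fun n => φ (x n)) atTop (𝓝 (φ w))) ∧
      IsNorming c Φ (Submodule.span ℝ (insert w (Set.range x)) : Set E) := by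
  classical
  choose Φ hΦ using fun S : Finset E =>
    exists_finset_isNorming (Submodule.span ℝ (S : Set E)) hc
  choose a haA ha using fun (S : Finset E) (n : ℕ) =>
    exists_mem_forall_abs_sub_lt_of_mem_closure hw (S.powerset.biUnion Φ)
      (ε := 1 / ((n : ℝ) + 1)) (by positivity)
  let S : ℕ → Finset E := fun n => Nat.rec {w} (fun k s => insert (a s k) s) n
  let x : ℕ → E := fun n => a (S n) n
  have hS : ∀ n, S (n + 1) = insert (x n) (S n) := fun n => rfl
  have hmono : Monotone S := monotone_nat_of_le_succ fun n => by
    rw [hS]; exact Finset.subset_insert _ _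
  refine ⟨x, ⋃ n, Φ (S n), fun n => haA _ _, ?_, ?_⟩
  · intro φ hφ
    obtain ⟨m, hm⟩ := Set.mem_iUnion.1 hφ
    refine tendsto_iff_norm_sub_tendsto_zero.2 <| squeeze_zero'
      (Eventually.of_forall fun _ => norm_nonneg _) ?_ tendsto_one_div_add_atTop_nhds_zero_nat
    filter_upwards [eventually_ge_atTop m] with n hn
    exact (ha (S n) n φ (Finset.mem_biUnion.2 ⟨S m, Finset.mem_powerset.2 (hmono hn), hm⟩)).le
  · have hsub : insert w (Set.range x) ⊆ ⋃ n, SetLike.coe (S n) := by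
      rintro _ (rfl | ⟨n, rfl⟩)
      · exact Set.mem_iUnion.2 ⟨0, by simp [S]⟩
      · exact Set.mem_iUnion.2 ⟨n + 1, by simp [hS]⟩
    have hdir : Directed (· ≤ ·) fun n => Submodule.span ℝ (SetLike.coe (S n)) :=
      Monotone.directed_le fun _ _ hij =>
        Submodule.span_mono (Finset.coe_subset.2 (hmono hij))
    intro z hz
    have hz' := Submodule.span_mono hsub hz
    rw [Submodule.span_iUnion] at hz'
    obtain ⟨n, hn⟩ := (Submodule.mem_iSup_of_directed _ hdir).1 hz'
    exact (hΦ (S n)).mono (Set.subset_iUnion (fun n => (Φ (S n) : Set (StrongDual ℝ E))) n) z hn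

theorem IsReflexive.exists_weaklyTendsto_of_mem_closure (hE : IsReflexive E) {A : Set E}
    (hA : Bornology.IsBounded A) {w : E}
    (hw : toWeakSpace ℝ E w ∈ closure (toWeakSpace ℝ E '' A)) :
    ∃ x : ℕ → E, (∀ n, x n ∈ A) ∧ WeaklyTendsto x w := by
  obtain ⟨x, Φ, hxA, hΦ, hnorm⟩ := exists_seq_isNorming_of_mem_closure hw one_half_lt_one
  refine ⟨x, hxA, (hE.isCompact_closure_image_toWeakSpace hA).tendsto_nhds_of_unique_mapClusterPt
    (Eventually.of_forall fun n => subset_closure ⟨x n, hxA n, rfl⟩) fun y _ hy => ?_⟩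
  obtain ⟨y, rfl⟩ := (toWeakSpace ℝ E).surjective y
  let W := Submodule.span ℝ (insert w (Set.range x))
  have hwW : w ∈ W.topologicalClosure :=
    W.le_topologicalClosure (Submodule.subset_span (Set.mem_insert _ _))
  have hyW : y ∈ W.topologicalClosure := (toWeakSpace ℝ E).injective.mem_set_image.1 <|
    (isClosed_image_toWeakSpace W.isClosed_topologicalClosure
      W.topologicalClosure.convex).mem_of_mapClusterPt hy <| Eventually.of_forall fun n =>
        Set.mem_image_of_mem _ <| W.le_topologicalClosure <|
          Submodule.subset_span (Set.mem_insert_of_mem _ ⟨n, rfl⟩)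
  have hzero : ∀ φ ∈ Φ, φ (y - w) = 0 := fun φ hφ => by
    have hφy : MapClusterPt (φ y) atTop fun n => φ (x n) :=
      MapClusterPt.continuousAt_comp (f := fun z : WeakSpace ℝ E => φ ((toWeakSpace ℝ E).symm z))
        (continuous_toWeakSpace_symm_dual φ).continuousAt hy
    rw [map_sub, sub_eq_zero]
    exact eq_of_nhds_neBot (hφy.clusterPt.mono (hΦ φ hφ)).neBot
  rw [sub_eq_zero.1 (hnorm.eq_zero_of_mem_closure one_half_pos (sub_mem hyW hwW) hzero)]

/-- A form of the **Eberlein–Šmulian theorem**. -/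
theorem IsReflexive.isCompact_image_toWeakSpace (hE : IsReflexive E) {A : Set E}
    (hA : Bornology.IsBounded A) (hseq : IsWeaklySeqClosed A) :
    IsCompact (toWeakSpace ℝ E '' A) := by
  suffices closure (toWeakSpace ℝ E '' A) = toWeakSpace ℝ E '' A from
    this ▸ hE.isCompact_closure_image_toWeakSpace hA
  refine Set.Subset.antisymm (fun w hw => ?_) subset_closure
  obtain ⟨w, rfl⟩ := (toWeakSpace ℝ E).surjective w
  obtain ⟨x, hxA, hxw⟩ := hE.exists_weaklyTendsto_of_mem_closure hA hw
  exact Set.mem_image_of_mem _ (hseq hxA hxw)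

end EberleinSmulian

theorem exists_linearMap_eq_and_forall_le_of_sublinear {E : Type*} [AddCommGroup E] [Module ℝ E]
    {p : E → ℝ} (hsmul : ∀ c : ℝ, 0 < c → ∀ x, p (c • x) = c * p x)
    (hadd : ∀ x y, p (x + y) ≤ p x + p y) (y : E) :
    ∃ g : E →ₗ[ℝ] ℝ, g y = p y ∧ ∀ z, g z ≤ p z := by
  have hp0 : p 0 = 0 := by
    have h2 := hsmul 2 two_pos 0
    rw [smul_zero] at h2
    linarith
  rcases eq_or_ne y 0 with rfl | hy
  · obtain ⟨g, -, hg⟩ := exists_extension_of_le_sublinear (⟨⊥, 0⟩ : E →ₗ.[ℝ] ℝ) p hsmul hadd <| by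
      rintro ⟨z, hz⟩
      obtain rfl : z = 0 := by simpa using hz
      simp [hp0]
    exact ⟨g, by rw [map_zero, hp0], hg⟩
  · have hspan : ∀ c : ℝ, c * p y ≤ p (c • y) := fun c => by
      rcases lt_trichotomy c 0 with hc | rfl | hc
      · have hneg := hsmul (-c) (neg_pos.2 hc) y
        have hsum := hadd (c • y) (-c • y)
        rw [neg_smul, add_neg_cancel, hp0] at hsum
        rw [neg_smul] at hneg
        linarith
      · simp [hp0]
      · exact (hsmul c hc y).ge
    obtain ⟨g, hgy, hg⟩ := exists_extension_of_le_sublinear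
      (LinearPMap.mkSpanSingleton (K := ℝ) y (p y) hy) p hsmul hadd <| by
        rintro ⟨z, hz⟩
        obtain ⟨c, rfl⟩ := Submodule.mem_span_singleton.1 hz
        rw [LinearPMap.mkSpanSingleton'_apply]
        exact hspan c
    exact ⟨g, (hgy ⟨y, Submodule.mem_span_singleton_self y⟩).trans
      (LinearPMap.mkSpanSingleton_apply ℝ ℝ hy (p y)), hg⟩

section Clarke

variable {E : Type*} [NormedAddCommGroup E] [NormedSpace ℝ E] {h : E → ℝ}

theorem tendsto_fst_add_snd_smul (x y : E) :
    Tendsto (fun p : E × ℝ => p.1 + p.2 • y) (𝓝 x ×ˢ 𝓝[>] (0 : ℝ)) (𝓝 x) := by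
  have hcont : Continuous fun p : E × ℝ => p.1 + p.2 • y := by fun_prop
  have hlim := hcont.tendsto (x, (0 : ℝ))
  rw [zero_smul, add_zero, nhds_prod_eq] at hlim
  exact hlim.mono_left (prod_mono le_rfl nhdsWithin_le_nhds)

theorem eventually_snd_pos {α : Type*} (l : Filter α) :
    ∀ᶠ p : α × ℝ in l ×ˢ 𝓝[>] (0 : ℝ), 0 < p.2 :=
  tendsto_snd.eventually (eventually_mem_nhdsWithin (a := (0 : ℝ)) (s := Set.Ioi 0))

theorem eventually_diffQuot_le {K : NNReal} {U : Set E} {x : E} (hU : U ∈ 𝓝 x)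
    (hK : LipschitzOnWith K h U) (y z : E) :
    ∀ᶠ p : E × ℝ in 𝓝 x ×ˢ 𝓝[>] (0 : ℝ), (h (p.1 + p.2 • y) - h p.1) / p.2 ≤
      (h (p.1 + p.2 • z) - h p.1) / p.2 + K * ‖y - z‖ := by
  filter_upwards [(tendsto_fst_add_snd_smul x y).eventually hU,
    (tendsto_fst_add_snd_smul x z).eventually hU, eventually_snd_pos _] with p hy hz hp
  have hlip := (Real.le_norm_self _).trans (hK.norm_sub_le hy hz)
  rw [add_sub_add_left_eq_sub, ← smul_sub, norm_smul, Real.norm_of_nonneg hp.le] at hlip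
  rw [div_add' _ _ _ hp.ne']
  gcongr
  linarith

theorem exists_forall_eventually_abs_diffQuot_le (hh : LocallyLipschitz h) (x : E) :
    ∃ K : ℝ, ∀ y, ∀ᶠ p : E × ℝ in 𝓝 x ×ˢ 𝓝[>] (0 : ℝ),
      |(h (p.1 + p.2 • y) - h p.1) / p.2| ≤ K * ‖y‖ := by
  obtain ⟨K, U, hU, hK⟩ := hh x
  refine ⟨K, fun y => ?_⟩
  filter_upwards [eventually_diffQuot_le hU hK y 0, eventually_diffQuot_le hU hK 0 y] with p h1 h2
  simp only [smul_zero, add_zero, sub_self, zero_div, sub_zero, zero_add, zero_sub, norm_neg]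
    at h1 h2
  exact abs_le.2 ⟨by linarith, h1⟩

theorem clarkeDeriv_le_of_eventually (hh : LocallyLipschitz h) {x y : E} {a : ℝ}
    (ha : ∀ᶠ p : E × ℝ in 𝓝 x ×ˢ 𝓝[>] (0 : ℝ), (h (p.1 + p.2 • y) - h p.1) / p.2 ≤ a) :
    clarkeDeriv h x y ≤ a := by
  obtain ⟨K, hK⟩ := exists_forall_eventually_abs_diffQuot_le hh x
  have hbdd : IsBoundedUnder (· ≥ ·) (𝓝 x ×ˢ 𝓝[>] (0 : ℝ))
      fun p : E × ℝ => (h (p.1 + p.2 • y) - h p.1) / p.2 :=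
    isBoundedUnder_of_eventually_ge ((hK y).mono fun _ hp => (abs_le.1 hp).1)
  exact limsup_le_of_le hbdd.isCoboundedUnder_le ha

theorem eventually_lt_of_clarkeDeriv_lt (hh : LocallyLipschitz h) {x y : E} {a : ℝ}
    (ha : clarkeDeriv h x y < a) :
    ∀ᶠ p : E × ℝ in 𝓝 x ×ˢ 𝓝[>] (0 : ℝ), (h (p.1 + p.2 • y) - h p.1) / p.2 < a := by
  obtain ⟨K, hK⟩ := exists_forall_eventually_abs_diffQuot_le hh x
  exact eventually_lt_of_limsup_lt ha
    (isBoundedUnder_of_eventually_le ((hK y).mono fun _ hp => (abs_le.1 hp).2))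

theorem exists_forall_clarkeDeriv_le (hh : LocallyLipschitz h) (x : E) :
    ∃ K : ℝ, ∀ y, clarkeDeriv h x y ≤ K * ‖y‖ := by
  obtain ⟨K, hK⟩ := exists_forall_eventually_abs_diffQuot_le hh x
  exact ⟨K, fun y => clarkeDeriv_le_of_eventually hh ((hK y).mono fun _ hp => (abs_le.1 hp).2)⟩

theorem clarkeDeriv_zero (h : E → ℝ) (x : E) : clarkeDeriv h x 0 = 0 := by
  simp [clarkeDeriv]

theorem clarkeDeriv_add_le (hh : LocallyLipschitz h) (x y z : E) :
    clarkeDeriv h x (y + z) ≤ clarkeDeriv h x y + clarkeDeriv h x z := by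
  refine le_of_forall_pos_le_add fun ε hε => clarkeDeriv_le_of_eventually hh ?_
  have hshift : Tendsto (fun p : E × ℝ => (p.1 + p.2 • y, p.2)) (𝓝 x ×ˢ 𝓝[>] (0 : ℝ))
      (𝓝 x ×ˢ 𝓝[>] (0 : ℝ)) := (tendsto_fst_add_snd_smul x y).prodMk tendsto_snd
  filter_upwards [eventually_lt_of_clarkeDeriv_lt hh
      (lt_add_of_pos_right (clarkeDeriv h x y) (half_pos hε)),
    hshift.eventually (eventually_lt_of_clarkeDeriv_lt hh
      (lt_add_of_pos_right (clarkeDeriv h x z) (half_pos hε)))] with p hy hz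
  have hsplit : (h (p.1 + p.2 • (y + z)) - h p.1) / p.2 =
      (h (p.1 + p.2 • y) - h p.1) / p.2 +
        (h (p.1 + p.2 • y + p.2 • z) - h (p.1 + p.2 • y)) / p.2 := by
    rw [smul_add, ← add_assoc]; ring
  rw [hsplit]
  linarith

theorem clarkeDeriv_smul_le (hh : LocallyLipschitz h) (x y : E) {s : ℝ} (hs : 0 < s) :
    clarkeDeriv h x (s • y) ≤ s * clarkeDeriv h x y := by
  refine le_of_forall_pos_le_add fun ε hε => clarkeDeriv_le_of_eventually hh ?_
  have hmul : Tendsto (fun t : ℝ => s * t) (𝓝[>] (0 : ℝ)) (𝓝[>] (0 : ℝ)) := by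
    refine tendsto_nhdsWithin_iff.2 ⟨?_, ?_⟩
    · have hcont : Continuous fun t : ℝ => s * t := by fun_prop
      simpa using (hcont.tendsto 0).mono_left (nhdsWithin_le_nhds (s := Set.Ioi 0))
    · filter_upwards [self_mem_nhdsWithin] with t ht using mul_pos hs ht
  have hscale : Tendsto (fun p : E × ℝ => (p.1, s * p.2)) (𝓝 x ×ˢ 𝓝[>] (0 : ℝ))
      (𝓝 x ×ˢ 𝓝[>] (0 : ℝ)) := tendsto_fst.prodMk (hmul.comp tendsto_snd)
  filter_upwards [hscale.eventually (eventually_lt_of_clarkeDeriv_lt hh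
      (lt_add_of_pos_right (clarkeDeriv h x y) (div_pos hε hs))),
    eventually_snd_pos _] with p hp hpos
  calc (h (p.1 + p.2 • s • y) - h p.1) / p.2
      = s * ((h (p.1 + (s * p.2) • y) - h p.1) / (s * p.2)) := by
        rw [smul_smul, mul_comm p.2 s]; field_simp
    _ ≤ s * (clarkeDeriv h x y + ε / s) := by gcongr
    _ = s * clarkeDeriv h x y + ε := by field_simp

theorem clarkeDeriv_smul (hh : LocallyLipschitz h) (x y : E) {s : ℝ} (hs : 0 ≤ s) :
    clarkeDeriv h x (s • y) = s * clarkeDeriv h x y := by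
  rcases hs.eq_or_lt with rfl | hs
  · rw [zero_smul, clarkeDeriv_zero, zero_mul]
  refine le_antisymm (clarkeDeriv_smul_le hh x y hs) ?_
  have hinv := clarkeDeriv_smul_le hh x (s • y) (inv_pos.2 hs)
  rwa [inv_smul_smul₀ hs.ne', le_inv_mul_iff₀ hs] at hinv

theorem neg_clarkeDeriv_neg_le (hh : LocallyLipschitz h) (x y : E) :
    -clarkeDeriv h x (-y) ≤ clarkeDeriv h x y := by
  have hsum := clarkeDeriv_add_le hh x y (-y)
  rw [add_neg_cancel, clarkeDeriv_zero] at hsum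
  linarith

theorem convexOn_clarkeDeriv (hh : LocallyLipschitz h) (x : E) :
    ConvexOn ℝ Set.univ (clarkeDeriv h x) := by
  refine ⟨convex_univ, fun y _ z _ a b ha hb _ => ?_⟩
  rw [smul_eq_mul, smul_eq_mul, ← clarkeDeriv_smul hh x y ha, ← clarkeDeriv_smul hh x z hb]
  exact clarkeDeriv_add_le hh x _ _

theorem continuous_clarkeDeriv (hh : LocallyLipschitz h) (x : E) :
    Continuous (clarkeDeriv h x) := by
  obtain ⟨K, hK⟩ := exists_forall_clarkeDeriv_le hh x
  refine (LipschitzWith.of_le_add_mul' K fun y z => ?_).continuous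
  have hsum := clarkeDeriv_add_le hh x z (y - z)
  rw [add_sub_cancel] at hsum
  rw [dist_eq_norm]
  linarith [hK (y - z)]

theorem upperSemicontinuous_clarkeDeriv (hh : LocallyLipschitz h) :
    UpperSemicontinuous fun q : E × E => clarkeDeriv h q.1 q.2 := by
  rintro ⟨x, y⟩ a ha
  obtain ⟨b, hb, hba⟩ := exists_between ha
  obtain ⟨K, U, hU, hK⟩ := hh x
  have hquot : ∀ᶠ x' in 𝓝 x, ∀ᶠ p : E × ℝ in 𝓝 x' ×ˢ 𝓝[>] (0 : ℝ),
      (h (p.1 + p.2 • y) - h p.1) / p.2 < b := by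
    obtain ⟨P, hP, Q, hQ, hPQ⟩ := eventually_prod_iff.1 (eventually_lt_of_clarkeDeriv_lt hh hb)
    filter_upwards [eventually_eventually_nhds.2 hP] with x' hx'
    exact eventually_prod_iff.2 ⟨P, hx', Q, hQ, hPQ⟩
  have hclose : ∀ᶠ y' in 𝓝 y, b + K * ‖y' - y‖ < a := by
    have hcont : Continuous fun y' : E => b + K * ‖y' - y‖ := by fun_prop
    exact hcont.continuousAt.eventually (gt_mem_nhds (by simpa using hba))
  rw [nhds_prod_eq]
  filter_upwards [(hquot.and (eventually_mem_nhds_iff.2 hU)).prod_mk hclose]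
    with ⟨x', y'⟩ ⟨⟨hx', hUx'⟩, hy'⟩
  refine lt_of_le_of_lt (clarkeDeriv_le_of_eventually hh ?_) hy'
  filter_upwards [hx', eventually_diffQuot_le hUx' hK y' y] with p hp hlip
  linarith

theorem exists_mem_clarkeSubdiff_eq (hh : LocallyLipschitz h) (x y : E) :
    ∃ ξ ∈ clarkeSubdiff h x, ξ y = clarkeDeriv h x y := by
  obtain ⟨K, hK⟩ := exists_forall_clarkeDeriv_le hh x
  obtain ⟨g, hgy, hg⟩ := exists_linearMap_eq_and_forall_le_of_sublinear
    (fun c hc z => clarkeDeriv_smul hh x z hc.le) (clarkeDeriv_add_le hh x) y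
  refine ⟨g.mkContinuous K fun z => abs_le.2 ⟨?_, (hg z).trans (hK z)⟩, hg, hgy⟩
  have hneg := (hg (-z)).trans (hK (-z))
  rw [map_neg, norm_neg] at hneg
  linarith

end Clarke

section WeaklySeqLSC

variable {E : Type*} [NormedAddCommGroup E] [NormedSpace ℝ E]

/-- Lower semicontinuity along weakly convergent sequences. -/
def WeaklySeqLSC (f : E → ℝ) : Prop :=
  ∀ ⦃x : ℕ → E⦄ ⦃u : E⦄, WeaklyTendsto x u → ∀ a < f u, ∀ᶠ n in atTop, a < f (x n)

theorem weaklySeqLSC_of_tendsto {f : E → ℝ}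
    (hf : ∀ ⦃x : ℕ → E⦄ ⦃u : E⦄, WeaklyTendsto x u → Tendsto (fun n => f (x n)) atTop (𝓝 (f u))) :
    WeaklySeqLSC f :=
  fun _ _ hx _ ha => (hf hx).eventually_const_lt ha

theorem WeaklySeqLSC.add {f g : E → ℝ} (hf : WeaklySeqLSC f) (hg : WeaklySeqLSC g) :
    WeaklySeqLSC fun u => f u + g u := by
  intro x u hx a ha
  filter_upwards [hf hx (f u - (f u + g u - a) / 2) (by linarith),
    hg hx (g u - (f u + g u - a) / 2) (by linarith)] with n hfn hgn
  linarith

theorem WeaklySeqLSC.comp_clm {F : Type*} [NormedAddCommGroup F] [NormedSpace ℝ F] {f : F → ℝ}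
    (hf : WeaklySeqLSC f) (T : E →L[ℝ] F) : WeaklySeqLSC fun u => f (T u) :=
  fun _ _ hx => hf (hx.comp_clm T)

theorem weaklySeqLSC_apply_sub (ξ : StrongDual ℝ E) (v : E) :
    WeaklySeqLSC fun u => ξ (v - u) :=
  weaklySeqLSC_of_tendsto fun _ _ hx => by
    simpa only [map_sub] using (weaklyTendsto_iff.1 hx ξ).const_sub (ξ v)

theorem CondH1.weaklySeqLSC {A : E → StrongDual ℝ E} (hA : CondH1 A) (v : E) :
    WeaklySeqLSC fun u => A u (v - u) := by
  intro x u hx a ha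
  filter_upwards [eventually_lt_of_lt_liminf ((EReal.coe_lt_coe_iff.2 ha).trans_le (hA v x u hx))]
    with n hn using EReal.coe_lt_coe_iff.1 hn

end WeaklySeqLSC

section HemiForm

variable {E Z : Type*} [NormedAddCommGroup E] [NormedSpace ℝ E]
  [NormedAddCommGroup Z] [NormedSpace ℝ Z]

theorem eventually_mul_clarkeDeriv_lt {ι : Type*} {l : Filter ι} {h : Z → ℝ}
    (hh : LocallyLipschitz h) {c : ι → ℝ} {c₀ : ℝ} {x y : ι → Z} {x₀ y₀ : Z}
    (hc : Tendsto c l (𝓝 c₀)) (hc_nonneg : ∀ᶠ i in l, 0 ≤ c i) (hx : Tendsto x l (𝓝 x₀))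
    (hy : Tendsto y l (𝓝 y₀)) {b : ℝ} (hb : c₀ * clarkeDeriv h x₀ y₀ < b) :
    ∀ᶠ i in l, c i * clarkeDeriv h (x i) (y i) < b := by
  obtain ⟨d, hdb, hd⟩ : ∃ d, c₀ * d < b ∧ clarkeDeriv h x₀ y₀ < d := by
    have hcont : Continuous fun d : ℝ => c₀ * d := by fun_prop
    exact (((hcont.tendsto _).eventually_lt_const hb).filter_mono nhdsWithin_le_nhds |>.and
      (self_mem_nhdsWithin (s := Set.Ioi (clarkeDeriv h x₀ y₀)))).exists
  filter_upwards [(hx.prodMk_nhds hy).eventually (upperSemicontinuous_clarkeDeriv hh (x₀, y₀) d hd),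
    (hc.mul_const d).eventually_lt_const hdb, hc_nonneg] with i hid hcd hci
  exact (mul_le_mul_of_nonneg_left (le_of_lt hid) hci).trans_lt hcd

/-- The bifunction `⟨A u, v - u⟩ - c(u) h⁰(γ u; γ (v - u))` of a hemivariational inequality. -/
noncomputable def hemiForm (A : E → StrongDual ℝ E) (c : E → ℝ) (γ : E →L[ℝ] Z) (h : Z → ℝ)
    (u v : E) : ℝ :=
  A u (v - u) - c u * clarkeDeriv h (γ u) (γ (v - u))

variable {A : E → StrongDual ℝ E} {c : E → ℝ} {γ : E →L[ℝ] Z} {h : Z → ℝ}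

theorem hemiForm_self (A : E → StrongDual ℝ E) (c : E → ℝ) (γ : E →L[ℝ] Z) (h : Z → ℝ) (u : E) :
    hemiForm A c γ h u u = 0 := by
  rw [hemiForm, sub_self, map_zero, map_zero, clarkeDeriv_zero, mul_zero, sub_zero]

theorem hemiForm_add_smul (hh : LocallyLipschitz h) (u v : E) {t : ℝ} (ht : 0 ≤ t) :
    hemiForm A c γ h u (u + t • (v - u)) = t * hemiForm A c γ h u v := by
  rw [hemiForm, hemiForm, add_sub_cancel_left, map_smul, map_smul, clarkeDeriv_smul hh _ _ ht,
    smul_eq_mul]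
  ring

theorem concaveOn_hemiForm (A : E → StrongDual ℝ E) (γ : E →L[ℝ] Z) (hh : LocallyLipschitz h)
    {u : E} (hc : 0 ≤ c u) : ConcaveOn ℝ Set.univ (hemiForm A c γ h u) := by
  have hcentered : ConcaveOn ℝ Set.univ fun w => A u w - c u * clarkeDeriv h (γ u) (γ w) :=
    ((A u).toLinearMap.concaveOn convex_univ).sub
      (((convexOn_clarkeDeriv hh (γ u)).comp_linearMap γ.toLinearMap).smul hc)
  have htranslated := hcentered.translate_left (-u)
  simp only [Set.preimage_univ, Function.comp_def, ← sub_eq_add_neg] at htranslated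
  exact htranslated

theorem weaklySeqLSC_neg_mul_clarkeDeriv (hh : LocallyLipschitz h) (hγ : IsCompactOperator γ)
    (hc : WeaklyContinuous c) (hc_nonneg : ∀ u, 0 ≤ c u) (v : E) :
    WeaklySeqLSC fun u => -(c u * clarkeDeriv h (γ u) (γ (v - u))) := by
  intro x u hx a ha
  have hγx := hx.tendsto_of_isCompactOperator hγ
  have hγv : Tendsto (fun n => γ (v - x n)) atTop (𝓝 (γ (v - u))) := by
    simpa only [map_sub] using hγx.const_sub (γ v)
  filter_upwards [eventually_mul_clarkeDeriv_lt hh (hc.tendsto hx)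
    (Eventually.of_forall fun _ => hc_nonneg _) hγx hγv (lt_neg.1 ha)] with n hn using lt_neg.1 hn

theorem weaklySeqLSC_mul_clarkeDeriv_right (hh : LocallyLipschitz h) (hγ : IsCompactOperator γ)
    (r : ℝ) (z : Z) (v : E) : WeaklySeqLSC fun u => r * clarkeDeriv h z (γ (u - v)) :=
  weaklySeqLSC_of_tendsto fun x u hx => by
    have hγx : Tendsto (fun n => γ (x n - v)) atTop (𝓝 (γ (u - v))) := by
      simpa only [map_sub] using (hx.tendsto_of_isCompactOperator hγ).sub_const (γ v)
    exact (((continuous_clarkeDeriv hh z).tendsto _).comp hγx).const_mul r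

end HemiForm

section Dissipative

variable {E Z : Type*} [NormedAddCommGroup E] [NormedSpace ℝ E]
  [NormedAddCommGroup Z] [NormedSpace ℝ Z]

theorem tendsto_add_smul_nhdsGT_zero (u w : E) :
    Tendsto (fun t : ℝ => u + t • w) (𝓝[>] 0) (𝓝 u) := by
  have hcont : Continuous fun t : ℝ => u + t • w := by fun_prop
  simpa using (hcont.tendsto 0).mono_left (nhdsWithin_le_nhds (s := Set.Ioi 0))

/-- `T` can be selected almost upper semicontinuously at the origin, along every ray and tested in
the direction of that ray. This is what turns concave dissipativity into dissipativity. -/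
def HasRaySelections (T : E → Set (StrongDual ℝ E)) : Prop :=
  ∀ w : E, ∀ ε > 0, ∃ t : ℝ, 0 < t ∧ ∃ ζ₀ ∈ T 0, ∃ ζ ∈ T (t • w), (ζ₀ - ζ) w ≤ ε

-- Concavity of `β` at `0 = t / (1 + t) • w + 1 / (1 + t) • (-t • w)` bounds `β w` by the values of
-- `T` at the origin and at `-t • w`.
theorem RelaxedDissipative.nonpos {β : E → ℝ} {T : E → Set (StrongDual ℝ E)}
    (hT : RelaxedDissipative β T) (hβ : ConcaveOn ℝ Set.univ β) (hβ0 : β 0 ≤ 0)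
    (hsel : HasRaySelections T) (w : E) : β w ≤ 0 := by
  refine le_of_forall_pos_le_add fun ε hε => ?_
  obtain ⟨t, ht, ζ₀, hζ₀, ζ, hζ, hle⟩ := hsel (-w) ε hε
  have hdiss : t * (ζ₀ - ζ) (-w) ≤ t * ε := mul_le_mul_of_nonneg_left hle ht.le
  have hβt := hT 0 (t • -w) ζ₀ hζ₀ ζ hζ
  rw [sub_zero, map_smul, smul_eq_mul, ← neg_sub ζ₀ ζ, neg_apply, mul_neg] at hβt
  have hconc : t / (1 + t) * β w + 1 / (1 + t) * β (t • -w) ≤ β 0 := by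
    have hcomb : (t / (1 + t)) • w + (1 / (1 + t)) • t • -w = 0 := by
      rw [smul_smul, smul_neg, div_mul_eq_mul_div, one_mul, add_neg_cancel]
    rw [← hcomb]
    exact hβ.2 (Set.mem_univ w) (Set.mem_univ _) (by positivity) (by positivity)
      (by field_simp; ring)
  have hscaled : t * β w + β (t • -w) ≤ 0 := by
    have hquot : (t * β w + β (t • -w)) / (1 + t) ≤ 0 := by
      calc (t * β w + β (t • -w)) / (1 + t)
          = t / (1 + t) * β w + 1 / (1 + t) * β (t • -w) := by ring
        _ ≤ 0 := hconc.trans hβ0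
    simpa using (div_le_iff₀ (by positivity)).1 hquot
  rw [zero_add]
  exact le_of_mul_le_mul_left (by linarith) ht

theorem ConcavelyDissipative.relaxedDissipative_zero {T : E → Set (StrongDual ℝ E)}
    (hT : ConcavelyDissipative T) (hsel : HasRaySelections T) : RelaxedDissipative 0 T := by
  obtain ⟨β, hβ, hβ0, hβT⟩ := hT
  exact fun x y ζx hζx ζy hζy =>
    (hβT x y ζx hζx ζy hζy).trans (hβT.nonpos hβ hβ0 hsel (y - x))

variable {A : E → StrongDual ℝ E} {c : E → ℝ} {γ : E →L[ℝ] Z} {h : Z → ℝ}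

theorem Hemicontinuous.eventually_sub_apply_lt (hA : Hemicontinuous A) (u w : E) {ε : ℝ}
    (hε : 0 < ε) : ∀ᶠ t : ℝ in 𝓝[>] 0, A u w - A (u + t • w) w < ε := by
  have hlim := hA u (u + w) w
  rw [add_sub_cancel_left] at hlim
  filter_upwards [hlim.eventually_const_lt (sub_lt_self _ hε)] with t ht
  linarith

theorem eventually_mul_clarkeDeriv_add_smul_lt (hh : LocallyLipschitz h) (hc : Continuous c)
    (hc_nonneg : ∀ u, 0 ≤ c u) (u w : E) (z : Z) {ε : ℝ} (hε : 0 < ε) :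
    ∀ᶠ t : ℝ in 𝓝[>] 0, c (u + t • w) * clarkeDeriv h (γ (u + t • w)) z <
      c u * clarkeDeriv h (γ u) z + ε :=
  have hlim := tendsto_add_smul_nhdsGT_zero u w
  eventually_mul_clarkeDeriv_lt hh ((hc.tendsto u).comp hlim)
    (Eventually.of_forall fun _ => hc_nonneg _) ((γ.continuous.tendsto u).comp hlim)
    tendsto_const_nhds (lt_add_of_pos_right _ hε)

theorem Hemicontinuous.hasRaySelections (hA : Hemicontinuous A) :
    HasRaySelections fun x => {A x} := fun w ε hε => by
  obtain ⟨t, hAt, ht⟩ := ((hA.eventually_sub_apply_lt 0 w hε).and self_mem_nhdsWithin).exists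
  rw [zero_add] at hAt
  exact ⟨t, ht, A 0, rfl, A (t • w), rfl, hAt.le⟩

theorem Hemicontinuous.hasRaySelections_shiftedOp (hA : Hemicontinuous A)
    (hh : LocallyLipschitz h) (hc : Continuous c) (hc_nonneg : ∀ u, 0 ≤ c u) :
    HasRaySelections (shiftedOp A c γ h) := fun w ε hε => by
  obtain ⟨ξ₀, hξ₀, hξ₀w⟩ := exists_mem_clarkeSubdiff_eq hh (γ 0) (γ w)
  obtain ⟨t, ⟨hAt, hct⟩, ht⟩ := (((hA.eventually_sub_apply_lt 0 w (half_pos hε)).and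
    (eventually_mul_clarkeDeriv_add_smul_lt (γ := γ) hh hc hc_nonneg 0 w (γ w)
      (half_pos hε))).and self_mem_nhdsWithin).exists
  rw [zero_add] at hAt hct
  obtain ⟨ξ, hξ, -⟩ := exists_mem_clarkeSubdiff_eq hh (γ (t • w)) 0
  have hξw := mul_le_mul_of_nonneg_left (hξ (γ w)) (hc_nonneg (t • w))
  refine ⟨t, ht, _, ⟨ξ₀, hξ₀, rfl⟩, _, ⟨ξ, hξ, rfl⟩, ?_⟩
  rw [← hξ₀w] at hct
  simp only [sub_apply, smul_apply, ContinuousLinearMap.comp_apply, smul_eq_mul]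
  linarith

theorem CondH2.apply_sub_le (hA : CondH2 A) (u v : E) : A v (v - u) ≤ A u (v - u) :=
  sub_nonpos.1 <| hA.2.relaxedDissipative_zero hA.1.hasRaySelections u v (A u) rfl (A v) rfl

theorem CondH3.apply_sub_add_le (hA : CondH3 A c γ h) (hh : LocallyLipschitz h)
    (hc : Continuous c) (hc_nonneg : ∀ u, 0 ≤ c u) (u v : E) :
    A v (v - u) + c v * clarkeDeriv h (γ v) (γ (u - v)) ≤ hemiForm A c γ h u v := by
  obtain ⟨ξu, hξu, hu⟩ := exists_mem_clarkeSubdiff_eq hh (γ u) (γ (v - u))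
  obtain ⟨ξv, hξv, hv⟩ := exists_mem_clarkeSubdiff_eq hh (γ v) (γ (u - v))
  have hdiss := hA.2.relaxedDissipative_zero (hA.1.hasRaySelections_shiftedOp hh hc hc_nonneg)
    u v _ ⟨ξu, hξu, rfl⟩ _ ⟨ξv, hξv, rfl⟩
  have hv' : ξv (γ (v - u)) = -clarkeDeriv h (γ v) (γ (u - v)) := by
    rw [← hv, ← map_neg, ← map_neg, neg_sub]
  simp only [sub_apply, smul_apply, ContinuousLinearMap.comp_apply, smul_eq_mul,
    Pi.zero_apply, hu, hv'] at hdiss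
  rw [hemiForm]
  linarith

end Dissipative

section MintyPair

variable {E Z : Type*} [NormedAddCommGroup E] [NormedSpace ℝ E]
  [NormedAddCommGroup Z] [NormedSpace ℝ Z]

/-- `g` is a minorant of the bifunction `f`, weakly sequentially lower semicontinuous in the first
variable, from which `f` is recovered along segments as in Minty's lemma. -/
structure IsMintyPair (f g : E → E → ℝ) : Prop where
  le : ∀ u v, g u v ≤ f u v
  weaklySeqLSC : ∀ v, WeaklySeqLSC fun u => g u v
  eventually_mul_le : ∀ u v : E, ∀ ε > 0, ∀ᶠ t : ℝ in 𝓝[>] 0,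
    t * (f u v - ε) ≤ g u (u + t • (v - u))

theorem IsMintyPair.prod {F : Type*} [NormedAddCommGroup F] [NormedSpace ℝ F]
    {f₁ g₁ : E → E → ℝ} {f₂ g₂ : F → F → ℝ} (h₁ : IsMintyPair f₁ g₁) (h₂ : IsMintyPair f₂ g₂) :
    IsMintyPair (fun u v : E × F => f₁ u.1 v.1 + f₂ u.2 v.2)
      (fun u v : E × F => g₁ u.1 v.1 + g₂ u.2 v.2) where
  le _ _ := add_le_add (h₁.le _ _) (h₂.le _ _)
  weaklySeqLSC v := ((h₁.weaklySeqLSC v.1).comp_clm (.fst ℝ E F)).add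
    ((h₂.weaklySeqLSC v.2).comp_clm (.snd ℝ E F))
  eventually_mul_le u v ε hε := by
    filter_upwards [h₁.eventually_mul_le u.1 v.1 (ε / 2) (half_pos hε),
      h₂.eventually_mul_le u.2 v.2 (ε / 2) (half_pos hε)] with t ht₁ ht₂
    simp only [Prod.fst_add, Prod.snd_add, Prod.smul_fst, Prod.smul_snd, Prod.fst_sub,
      Prod.snd_sub]
    linarith

variable {A : E → StrongDual ℝ E} {c : E → ℝ} {γ : E →L[ℝ] Z} {h : Z → ℝ}

theorem CondH1.isMintyPair (hA : CondH1 A) (hh : LocallyLipschitz h) (hγ : IsCompactOperator γ)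
    (hc : WeaklyContinuous c) (hc_nonneg : ∀ u, 0 ≤ c u) :
    IsMintyPair (hemiForm A c γ h) (hemiForm A c γ h) where
  le _ _ := le_rfl
  weaklySeqLSC v := by
    simpa only [hemiForm, sub_eq_add_neg (A _ _)] using
      (hA.weaklySeqLSC v).add (weaklySeqLSC_neg_mul_clarkeDeriv hh hγ hc hc_nonneg v)
  eventually_mul_le u v ε hε := by
    filter_upwards [self_mem_nhdsWithin] with t (ht : 0 < t)
    rw [hemiForm_add_smul hh u v ht.le]
    exact mul_le_mul_of_nonneg_left (sub_le_self _ hε.le) ht.le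

theorem CondH2.isMintyPair (hA : CondH2 A) (hh : LocallyLipschitz h) (hγ : IsCompactOperator γ)
    (hc : WeaklyContinuous c) (hc_nonneg : ∀ u, 0 ≤ c u) :
    IsMintyPair (hemiForm A c γ h)
      (fun u v => A v (v - u) - c u * clarkeDeriv h (γ u) (γ (v - u))) where
  le u v := sub_le_sub_right (hA.apply_sub_le u v) _
  weaklySeqLSC v := by
    simpa only [sub_eq_add_neg (A v _)] using
      (weaklySeqLSC_apply_sub (A v) v).add (weaklySeqLSC_neg_mul_clarkeDeriv hh hγ hc hc_nonneg v)
  eventually_mul_le u v ε hε := by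
    filter_upwards [self_mem_nhdsWithin, hA.1.eventually_sub_apply_lt u (v - u) hε]
      with t (ht : 0 < t) hAt
    rw [add_sub_cancel_left, map_smul, map_smul, clarkeDeriv_smul hh _ _ ht.le, smul_eq_mul,
      mul_left_comm, ← mul_sub, hemiForm]
    exact mul_le_mul_of_nonneg_left (by linarith) ht.le

theorem CondH3.isMintyPair (hA : CondH3 A c γ h) (hh : LocallyLipschitz h)
    (hγ : IsCompactOperator γ) (hc : Continuous c) (hc_nonneg : ∀ u, 0 ≤ c u) :
    IsMintyPair (hemiForm A c γ h)
      (fun u v => A v (v - u) + c v * clarkeDeriv h (γ v) (γ (u - v))) where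
  le u v := hA.apply_sub_add_le hh hc hc_nonneg u v
  weaklySeqLSC v := (weaklySeqLSC_apply_sub (A v) v).add
    (weaklySeqLSC_mul_clarkeDeriv_right hh hγ (c v) (γ v) v)
  eventually_mul_le u v ε hε := by
    filter_upwards [self_mem_nhdsWithin, hA.1.eventually_sub_apply_lt u (v - u) (half_pos hε),
      eventually_mul_clarkeDeriv_add_smul_lt (γ := γ) hh hc hc_nonneg u (v - u) (γ (v - u))
        (half_pos hε)] with t (ht : 0 < t) hAt hct
    set z := u + t • (v - u)
    have hzu : z - u = t • (v - u) := add_sub_cancel_left _ _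
    have huz : u - z = t • -(v - u) := by rw [← neg_sub, hzu, smul_neg]
    have hneg := mul_le_mul_of_nonneg_left (neg_clarkeDeriv_neg_le hh (γ z) (γ (v - u)))
      (hc_nonneg z)
    rw [hzu, huz, map_smul, map_smul, clarkeDeriv_smul hh _ _ ht.le, smul_eq_mul, map_neg,
      mul_left_comm, ← mul_add, hemiForm]
    exact mul_le_mul_of_nonneg_left (by linarith) ht.le

theorem exists_isMintyPair_hemiForm (hh : LocallyLipschitz h) (hγ : IsCompactOperator γ)
    (hc : WeaklyContinuous c) (hc_nonneg : ∀ u, 0 ≤ c u)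
    (hA : CondH1 A ∨ CondH2 A ∨ CondH3 A c γ h) : ∃ g, IsMintyPair (hemiForm A c γ h) g := by
  rcases hA with hA | hA | hA
  · exact ⟨_, hA.isMintyPair hh hγ hc hc_nonneg⟩
  · exact ⟨_, hA.isMintyPair hh hγ hc hc_nonneg⟩
  · exact ⟨_, hA.isMintyPair hh hγ hc.continuous hc_nonneg⟩

end MintyPair

section Equilibrium

variable {E : Type*} [NormedAddCommGroup E] [NormedSpace ℝ E]
  {C D : Set E} {ψ : E → ℝ} {f g : E → E → ℝ}

/-- The points of `C ∩ D` that solve, against the single competitor `v`, the equilibrium problem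
`g u v ≤ ψ v - ψ u`. -/
def mintySet (C D : Set E) (ψ : E → ℝ) (g : E → E → ℝ) (v : E) : Set E :=
  {u | u ∈ C ∩ D ∧ ψ u + g u v ≤ ψ v}

theorem isWeaklySeqClosed_mintySet (hCc : IsClosed C) (hC : Convex ℝ C) (hψ : ConvexOn ℝ D ψ)
    (hψc : ∀ a, IsClosed {x | x ∈ D ∧ ψ x ≤ a}) {v : E} (hg : WeaklySeqLSC fun u => g u v) :
    IsWeaklySeqClosed (mintySet C D ψ g v) := by
  intro x u hx hxu
  have hsublevel : ∀ ε > 0, u ∈ D ∧ ψ u ≤ ψ v - g u v + ε := fun ε hε => by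
    refine mem_of_weaklyTendsto_of_frequently (hψc _) (hψ.convex_le _) hxu
      (Eventually.frequently ?_)
    filter_upwards [hg hxu _ (sub_lt_self _ hε)] with n hn
    exact ⟨(hx n).1.2, by linarith [(hx n).2]⟩
  have huC : u ∈ C := mem_of_weaklyTendsto_of_frequently hCc hC hxu
    (Frequently.of_forall fun n => (hx n).1.1)
  have hle := le_of_forall_pos_le_add fun ε hε => (hsublevel ε hε).2
  exact ⟨⟨huC, (hsublevel 1 one_pos).1⟩, by linarith⟩

theorem exists_pos_add_le_of_mem_stdSimplex {ι : Type*} [Fintype ι] (hψ : ConvexOn ℝ D ψ)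
    {l : ι → ℝ} (hl : l ∈ stdSimplex ℝ ι) {v : ι → E} (hv : ∀ i, v i ∈ D) {p : E → ℝ}
    (hp : ConcaveOn ℝ Set.univ p) (hp0 : p (∑ i, l i • v i) = 0) :
    ∃ i, 0 < l i ∧ ψ (∑ i, l i • v i) + p (v i) ≤ ψ (v i) := by
  set z := ∑ i, l i • v i
  have hψz : ψ z ≤ ∑ i, l i * ψ (v i) :=
    hψ.map_sum_le (fun i _ => hl.1 i) hl.2 fun i _ => hv i
  have hpz : ∑ i, l i * p (v i) ≤ 0 :=
    (hp.le_map_sum (fun i _ => hl.1 i) hl.2 fun i _ => Set.mem_univ _).trans_eq hp0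
  have hsum : ∑ i, l i * (ψ z + p (v i) - ψ (v i)) ≤ 0 := by
    simp only [mul_sub, mul_add, Finset.sum_sub_distrib, Finset.sum_add_distrib, ← Finset.sum_mul,
      hl.2, one_mul]
    linarith
  by_contra! hpos
  have hterm : ∀ i, 0 ≤ l i * (ψ z + p (v i) - ψ (v i)) := fun i =>
    (hl.1 i).eq_or_lt.elim (fun h0 => by rw [← h0, zero_mul])
      fun hi => (mul_pos hi (sub_pos.2 (hpos i hi))).le
  obtain ⟨i, -, hi⟩ : ∃ i ∈ Finset.univ, 0 < l i :=
    Finset.exists_lt_of_sum_lt (by simp only [Finset.sum_const_zero, hl.2, zero_lt_one])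
  exact hsum.not_gt <| Finset.sum_pos' (fun j _ => hterm j)
    ⟨i, Finset.mem_univ i, mul_pos hi (sub_pos.2 (hpos i hi))⟩

theorem exists_forall_mem_mintySet {ι : Type*} [Finite ι] [Nonempty ι] (hC : Convex ℝ C)
    (hψ : ConvexOn ℝ D ψ) (hclosed : ∀ v, IsClosed (mintySet C D ψ g v))
    (hgf : ∀ u v, g u v ≤ f u v) (hf : ∀ u, ConcaveOn ℝ Set.univ (f u)) (hf0 : ∀ u, f u u = 0)
    {v : ι → E} (hv : ∀ i, v i ∈ C ∩ D) : ∃ u, ∀ i, u ∈ mintySet C D ψ g (v i) := by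
  have := Fintype.ofFinite ι
  have hcont : Continuous fun l : ι → ℝ => ∑ i, l i • v i := by fun_prop
  obtain ⟨l, -, hl⟩ := exists_mem_stdSimplex_forall_mem
    (fun i => (hclosed (v i)).preimage hcont) fun l hl => by
      have hmem := (hC.inter hψ.1).sum_mem (fun i _ => hl.1 i) hl.2 fun i _ => hv i
      obtain ⟨i, hi, hle⟩ := exists_pos_add_le_of_mem_stdSimplex hψ hl (fun i => (hv i).2)
        (hf _) (hf0 _)
      exact ⟨i, hi, hmem, (add_le_add_right (hgf _ _) _).trans hle⟩
  exact ⟨_, hl⟩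

theorem IsReflexive.exists_forall_mem {ι : Type*} [Nonempty ι] (hE : IsReflexive E)
    {A : ι → Set E} (hb : ∀ i, Bornology.IsBounded (A i)) (hc : ∀ i, IsWeaklySeqClosed (A i))
    (hfin : ∀ S : Finset ι, S.Nonempty → ∃ u, ∀ i ∈ S, u ∈ A i) : ∃ u, ∀ i, u ∈ A i := by
  classical
  have hcompact := fun i => hE.isCompact_image_toWeakSpace (hb i) (hc i)
  obtain ⟨i₀⟩ := ‹Nonempty ι›
  obtain ⟨_, ⟨u, -, rfl⟩, hu⟩ := (hcompact i₀).inter_iInter_nonempty _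
    (fun i => (hcompact i).isClosed) fun S => by
      obtain ⟨u, hu⟩ := hfin (insert i₀ S) (S.insert_nonempty i₀)
      exact ⟨toWeakSpace ℝ E u, ⟨u, hu i₀ (S.mem_insert_self i₀), rfl⟩,
        Set.mem_iInter₂.2 fun i hi => ⟨u, hu i (Finset.mem_insert_of_mem hi), rfl⟩⟩
  exact ⟨u, fun i => (toWeakSpace ℝ E).injective.mem_set_image.1 (Set.mem_iInter.1 hu i)⟩

theorem IsMintyPair.le_sub_of_forall_mem_mintySet (hfg : IsMintyPair f g) (hC : Convex ℝ C)
    (hψ : ConvexOn ℝ D ψ) {u v : E} (hu : u ∈ C ∩ D) (hv : v ∈ C ∩ D)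
    (hmem : ∀ w ∈ C ∩ D, u ∈ mintySet C D ψ g w) : f u v ≤ ψ v - ψ u := by
  refine le_of_forall_pos_le_add fun ε hε => ?_
  obtain ⟨t, hft, ht0, ht1⟩ := ((hfg.eventually_mul_le u v ε hε).and
    (Ioo_mem_nhdsGT (zero_lt_one (α := ℝ)))).exists
  have hcomb : u + t • (v - u) = (1 - t) • u + t • v := by module
  have hminty := (hmem _ ((hC.inter hψ.1).add_smul_sub_mem hu hv ⟨ht0.le, ht1.le⟩)).2
  have hconv := hψ.2 hu.2 hv.2 (sub_nonneg.2 ht1.le) ht0.le (sub_add_cancel 1 t)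
  rw [← hcomb, smul_eq_mul, smul_eq_mul] at hconv
  have hscaled : t * (f u v - ε) ≤ t * (ψ v - ψ u) := by linarith
  linarith [le_of_mul_le_mul_left hscaled ht0]

theorem IsMintyPair.exists_forall_le_sub (hfg : IsMintyPair f g) (hE : IsReflexive E)
    (hCc : IsClosed C) (hC : Convex ℝ C) (hCb : Bornology.IsBounded C) (hψ : ConvexOn ℝ D ψ)
    (hψc : ∀ a, IsClosed {x | x ∈ D ∧ ψ x ≤ a}) (hCD : (C ∩ D).Nonempty)
    (hf : ∀ u, ConcaveOn ℝ Set.univ (f u)) (hf0 : ∀ u, f u u = 0) :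
    ∃ u ∈ C ∩ D, ∀ v ∈ C ∩ D, f u v ≤ ψ v - ψ u := by
  have hseq := fun v => isWeaklySeqClosed_mintySet hCc hC hψ hψc (hfg.weaklySeqLSC v)
  have : Nonempty (C ∩ D : Set E) := hCD.to_subtype
  obtain ⟨u, hu⟩ := hE.exists_forall_mem
    (A := fun v : (C ∩ D : Set E) => mintySet C D ψ g (v : E))
    (fun v => hCb.subset fun _ hu => hu.1.1) (fun v => hseq v) fun S hS => by
      have : Nonempty S := hS.coe_sort
      obtain ⟨u, hu⟩ := exists_forall_mem_mintySet hC hψ (fun v => (hseq v).isClosed) hfg.le hf hf0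
        fun i : S => i.1.2
      exact ⟨u, fun i hi => hu ⟨i, hi⟩⟩
  obtain ⟨v₀, hv₀⟩ := hCD
  have huCD : u ∈ C ∩ D := (hu ⟨v₀, hv₀⟩).1
  exact ⟨u, huCD, fun v hv =>
    hfg.le_sub_of_forall_mem_mintySet hC hψ huCD hv fun w hw => hu ⟨w, hw⟩⟩

end Equilibrium

section Functional

variable {X Y : Type*} {φ : X → EReal}

theorem coe_toReal_of_mem_effDomain (hbot : ∀ x, φ x ≠ ⊥) {x : X} (hx : x ∈ effDomain φ) :
    ((φ x).toReal : EReal) = φ x :=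
  EReal.coe_toReal (ne_of_lt hx) (hbot x)

theorem IsConvex.le_coe [NormedAddCommGroup X] [NormedSpace ℝ X] (hφ : IsConvex φ)
    (hbot : ∀ x, φ x ≠ ⊥) {x y : X} (hx : x ∈ effDomain φ) (hy : y ∈ effDomain φ) {a b : ℝ}
    (ha : 0 ≤ a) (hb : 0 ≤ b) (hab : a + b = 1) :
    φ (a • x + b • y) ≤ ((a * (φ x).toReal + b * (φ y).toReal : ℝ) : EReal) := by
  obtain rfl : b = 1 - a := by linarith
  have hle := hφ x y a ha (by linarith)
  rw [← coe_toReal_of_mem_effDomain hbot hx, ← coe_toReal_of_mem_effDomain hbot hy] at hle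
  exact_mod_cast hle

theorem IsConvex.convexOn_toReal [NormedAddCommGroup X] [NormedSpace ℝ X] (hφ : IsConvex φ)
    (hbot : ∀ x, φ x ≠ ⊥) : ConvexOn ℝ (effDomain φ) fun x => (φ x).toReal :=
  ⟨fun _ hx _ hy _ _ ha hb hab => (hφ.le_coe hbot hx hy ha hb hab).trans_lt (EReal.coe_lt_top _),
    fun _ hx _ hy _ _ ha hb hab => EReal.toReal_le_toReal (hφ.le_coe hbot hx hy ha hb hab)
      (hbot _) (EReal.coe_ne_top _)⟩

theorem IsConvex.convexOn_toReal_fst_add [NormedAddCommGroup X] [NormedSpace ℝ X]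
    [NormedAddCommGroup Y] [NormedSpace ℝ Y] (hφ : IsConvex φ) (hbot : ∀ x, φ x ≠ ⊥)
    {B : X × Y → ℝ} (hB : ConvexOn ℝ Set.univ B) :
    ConvexOn ℝ (effDomain φ ×ˢ (Set.univ : Set Y)) fun w => (φ w.1).toReal + B w := by
  have hφ' := hφ.convexOn_toReal hbot
  have hdom := hφ'.1.prod (convex_univ (𝕜 := ℝ) (E := Y))
  exact ((hφ'.comp_linearMap (.fst ℝ X Y)).subset (fun _ hw => hw.1) hdom).add
    (hB.subset (Set.subset_univ _) hdom)

theorem isClosed_sublevel_toReal_fst_add [TopologicalSpace X] [TopologicalSpace Y]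
    (hbot : ∀ x, φ x ≠ ⊥) (hφ : LowerSemicontinuous φ) {B : X × Y → ℝ}
    (hB : LowerSemicontinuous B) (a : ℝ) :
    IsClosed {w : X × Y | w ∈ effDomain φ ×ˢ (Set.univ : Set Y) ∧ (φ w.1).toReal + B w ≤ a} := by
  have hlsc : LowerSemicontinuous fun w : X × Y => φ w.1 + (B w : EReal) :=
    (hφ.comp continuous_fst).add'
      (continuous_coe_real_ereal.comp_lowerSemicontinuous hB EReal.coe_strictMono.monotone)
      fun w => EReal.continuousAt_add (.inr (EReal.coe_ne_bot _)) (.inl (hbot _))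
  convert hlsc.isClosed_preimage (a : EReal) using 1
  ext w
  by_cases hw : w.1 ∈ effDomain φ
  · simp only [Set.mem_ofPred_eq, Set.mem_prod, hw, Set.mem_univ, true_and, Set.mem_preimage,
      Set.mem_Iic]
    rw [← coe_toReal_of_mem_effDomain hbot hw, ← EReal.coe_add, EReal.coe_le_coe_iff,
      EReal.toReal_coe]
  · have htop : φ w.1 = ⊤ := not_lt_top_iff.1 hw
    simp [hw, htop]

end Functional

section System

variable {X Y Z₁ Z₂ : Type*} [NormedAddCommGroup X] [NormedSpace ℝ X]
  [NormedAddCommGroup Y] [NormedSpace ℝ Y] [NormedAddCommGroup Z₁] [NormedSpace ℝ Z₁]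
  [NormedAddCommGroup Z₂] [NormedSpace ℝ Z₂] {K : Set X} {Λ : Set Y} {φ : X → EReal}
  {J : Z₁ → ℝ} {L : Z₂ → ℝ} {γ₁ : X →L[ℝ] Z₁} {γ₂ : Y →L[ℝ] Z₂} {H : Y → ℝ} {B : X × Y → ℝ}
  {F : X → StrongDual ℝ X} {G : Y → StrongDual ℝ Y}

/-- The bifunction on `X × Y` whose equilibrium problem, for the functional `φ + B` on `K × Λ`, is
the coupled system. -/
noncomputable def coupledForm (γ₁ : X →L[ℝ] Z₁) (γ₂ : Y →L[ℝ] Z₂) (J : Z₁ → ℝ) (L : Z₂ → ℝ)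
    (H : Y → ℝ) (F : X → StrongDual ℝ X) (G : Y → StrongDual ℝ Y) (w w' : X × Y) : ℝ :=
  hemiForm F (fun _ => 1) γ₁ J w.1 w'.1 + hemiForm G H γ₂ L w.2 w'.2

theorem coupledForm_self (γ₁ : X →L[ℝ] Z₁) (γ₂ : Y →L[ℝ] Z₂) (J : Z₁ → ℝ) (L : Z₂ → ℝ)
    (H : Y → ℝ) (F : X → StrongDual ℝ X) (G : Y → StrongDual ℝ Y) (w : X × Y) :
    coupledForm γ₁ γ₂ J L H F G w w = 0 := by
  rw [coupledForm, hemiForm_self, hemiForm_self, add_zero]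

theorem concaveOn_coupledForm (γ₁ : X →L[ℝ] Z₁) (γ₂ : Y →L[ℝ] Z₂) (hJ : LocallyLipschitz J)
    (hL : LocallyLipschitz L) (hH : ∀ σ, 0 ≤ H σ) (F : X → StrongDual ℝ X)
    (G : Y → StrongDual ℝ Y) (w : X × Y) :
    ConcaveOn ℝ Set.univ (coupledForm γ₁ γ₂ J L H F G w) :=
  ((concaveOn_hemiForm F γ₁ hJ (c := fun _ => 1) zero_le_one).comp_linearMap (.fst ℝ X Y)).add
    ((concaveOn_hemiForm G γ₂ hL (hH w.2)).comp_linearMap (.snd ℝ X Y))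

theorem exists_isMintyPair_coupledForm (hJ : LocallyLipschitz J) (hL : LocallyLipschitz L)
    (hγ₁ : IsCompactOperator γ₁) (hγ₂ : IsCompactOperator γ₂) (hH : WeaklyContinuous H)
    (hH_nonneg : ∀ σ, 0 ≤ H σ) (hF : CondH1 F ∨ CondH2 F ∨ CondH3 F (fun _ => 1) γ₁ J)
    (hG : CondH1 G ∨ CondH2 G ∨ CondH3 G H γ₂ L) :
    ∃ g, IsMintyPair (coupledForm γ₁ γ₂ J L H F G) g := by
  obtain ⟨g₁, hg₁⟩ :=
    exists_isMintyPair_hemiForm hJ hγ₁ (c := fun _ => 1) continuous_const (fun _ => zero_le_one) hF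
  obtain ⟨g₂, hg₂⟩ := exists_isMintyPair_hemiForm hL hγ₂ hH hH_nonneg hG
  exact ⟨_, hg₁.prod hg₂⟩

theorem isSolution_of_forall_coupledForm_le_sub (hbot : ∀ x, φ x ≠ ⊥) {w : X × Y}
    (hw : w ∈ (K ×ˢ Λ) ∩ effDomain φ ×ˢ Set.univ)
    (hle : ∀ w' ∈ (K ×ˢ Λ) ∩ effDomain φ ×ˢ Set.univ, coupledForm γ₁ γ₂ J L H F G w w' ≤
      (φ w'.1).toReal + B w' - ((φ w.1).toReal + B w)) :
    IsSolution K Λ B φ γ₁ γ₂ J L H F G w.1 w.2 := by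
  obtain ⟨u, σ⟩ := w
  obtain ⟨⟨hu, hσ⟩, huD, -⟩ := hw
  refine ⟨⟨hu, huD⟩, hσ, fun v hv => ?_, fun μ hμ => ?_⟩
  · rw [← coe_toReal_of_mem_effDomain hbot huD]
    by_cases hvD : v ∈ effDomain φ
    · have hvle := hle (v, σ) ⟨⟨hv, hσ⟩, hvD, trivial⟩
      simp only [coupledForm, hemiForm_self, add_zero] at hvle
      simp only [hemiForm, one_mul] at hvle
      rw [← coe_toReal_of_mem_effDomain hbot hvD]
      norm_cast
      linarith
    · have hv_top : φ v = ⊤ := not_lt_top_iff.1 hvD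
      rw [hv_top, EReal.top_sub_coe, EReal.coe_add_top, EReal.top_add_coe]
      exact le_top
  · have hμle := hle (u, μ) ⟨⟨hu, hμ⟩, huD, trivial⟩
    simp only [coupledForm, hemiForm_self, zero_add] at hμle
    simp only [hemiForm] at hμle
    linarith

end System

end VarHemivar

open VarHemivar in
theorem mainTheorem2_general
    {X Y Z₁ Z₂ : Type*}
    [NormedAddCommGroup X] [NormedSpace ℝ X] [NormedAddCommGroup Y] [NormedSpace ℝ Y]
    [NormedAddCommGroup Z₁] [NormedSpace ℝ Z₁] [NormedAddCommGroup Z₂] [NormedSpace ℝ Z₂]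
    (hX : IsReflexive X) (hY : IsReflexive Y)
    {K : Set X} (hK_bdd : Bornology.IsBounded K) (hK_closed : IsClosed K) (hK_conv : Convex ℝ K)
    {Λ : Set Y} (hΛ_ne : Λ.Nonempty) (hΛ_bdd : Bornology.IsBounded Λ) (hΛ_closed : IsClosed Λ)
    (hΛ_conv : Convex ℝ Λ)
    {φ : X → EReal} (hφ_bot : ∀ x, φ x ≠ ⊥) (hφ_conv : IsConvex φ)
    (hφ_lsc : LowerSemicontinuous φ) (hφK : (effDomain φ ∩ K).Nonempty)
    {J : Z₁ → ℝ} (hJ : LocallyLipschitz J) {L : Z₂ → ℝ} (hL : LocallyLipschitz L)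
    {γ₁ : X →L[ℝ] Z₁} (hγ₁ : IsCompactOperator γ₁) {γ₂ : Y →L[ℝ] Z₂} (hγ₂ : IsCompactOperator γ₂)
    {H : Y → ℝ} (hH_nonneg : ∀ σ, 0 ≤ H σ) (hH_cont : WeaklyContinuous H)
    {B : X × Y → ℝ} (hB_conv : ConvexOn ℝ Set.univ B) (hB_lsc : LowerSemicontinuous B)
    {F : X → StrongDual ℝ X} (hF : CondH1 F ∨ CondH2 F ∨ CondH3 F (fun _ => 1) γ₁ J)
    {G : Y → StrongDual ℝ Y} (hG : CondH1 G ∨ CondH2 G ∨ CondH3 G H γ₂ L) :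
    ∃ (u : X) (σ : Y), IsSolution K Λ B φ γ₁ γ₂ J L H F G u σ := by
  obtain ⟨g, hg⟩ := exists_isMintyPair_coupledForm hJ hL hγ₁ hγ₂ hH_cont hH_nonneg hF hG
  obtain ⟨u₀, hu₀D, hu₀K⟩ := hφK
  obtain ⟨σ₀, hσ₀⟩ := hΛ_ne
  have hdom : ((K ×ˢ Λ) ∩ effDomain φ ×ˢ Set.univ).Nonempty :=
    ⟨(u₀, σ₀), ⟨hu₀K, hσ₀⟩, hu₀D, trivial⟩
  obtain ⟨w, hw, hle⟩ := hg.exists_forall_le_sub (hX.prod hY) (hK_closed.prod hΛ_closed)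
    (hK_conv.prod hΛ_conv) (hK_bdd.prod hΛ_bdd) (hφ_conv.convexOn_toReal_fst_add hφ_bot hB_conv)
    (isClosed_sublevel_toReal_fst_add hφ_bot hφ_lsc hB_lsc) hdom
    (concaveOn_coupledForm γ₁ γ₂ hJ hL hH_nonneg F G) (coupledForm_self γ₁ γ₂ J L H F G)
  exact ⟨w.1, w.2, isSolution_of_forall_coupledForm_le_sub hφ_bot hw hle⟩

theorem mainTheorem2
    {X Y Z₁ Z₂ : Type*}
    [NormedAddCommGroup X] [NormedSpace ℝ X] [CompleteSpace X]
    [NormedAddCommGroup Y] [NormedSpace ℝ Y] [CompleteSpace Y]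
    [NormedAddCommGroup Z₁] [NormedSpace ℝ Z₁] [CompleteSpace Z₁]
    [NormedAddCommGroup Z₂] [NormedSpace ℝ Z₂] [CompleteSpace Z₂]
    (hX : VarHemivar.IsReflexive X) (hY : VarHemivar.IsReflexive Y)
    (K : Set X) (hK_ne : K.Nonempty) (hK_bdd : Bornology.IsBounded K)
    (hK_closed : IsClosed K) (hK_conv : Convex ℝ K)
    (Λ : Set Y) (hΛ_ne : Λ.Nonempty) (hΛ_bdd : Bornology.IsBounded Λ)
    (hΛ_closed : IsClosed Λ) (hΛ_conv : Convex ℝ Λ)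
    (φ : X → EReal) (hφ_bot : ∀ x, φ x ≠ ⊥) (hφ_conv : VarHemivar.IsConvex φ)
    (hφ_lsc : LowerSemicontinuous φ) (hφK : (VarHemivar.effDomain φ ∩ K).Nonempty)
    (J : Z₁ → ℝ) (hJ : LocallyLipschitz J) (L : Z₂ → ℝ) (hL : LocallyLipschitz L)
    (γ₁ : X →L[ℝ] Z₁) (hγ₁ : IsCompactOperator γ₁)
    (γ₂ : Y →L[ℝ] Z₂) (hγ₂ : IsCompactOperator γ₂)
    (H : Y → ℝ) (m_H : ℝ) (hH_range : ∀ σ, 0 < H σ ∧ H σ < m_H)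
    (hH_cont : VarHemivar.WeaklyContinuous H)
    (B : X × Y → ℝ) (hB_conv : ConvexOn ℝ Set.univ B) (hB_lsc : LowerSemicontinuous B)
    (F : X → StrongDual ℝ X)
    (hF : VarHemivar.CondH1 F ∨ VarHemivar.CondH2 F ∨
      VarHemivar.CondH3 F (fun _ => 1) γ₁ J)
    (G : Y → StrongDual ℝ Y)
    (hG : VarHemivar.CondH1 G ∨ VarHemivar.CondH2 G ∨
      VarHemivar.CondH3 G H γ₂ L) :
    ∃ (u : X) (σ : Y), VarHemivar.IsSolution K Λ B φ γ₁ γ₂ J L H F G u σ :=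
  mainTheorem2_general hX hY hK_bdd hK_closed hK_conv hΛ_ne hΛ_bdd hΛ_closed hΛ_conv hφ_bot hφ_conv
    hφ_lsc hφK hJ hL hγ₁ hγ₂ (fun σ => (hH_range σ).1.le) hH_cont hB_conv hB_lsc hF hG
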